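/- Let $\mathcal H$ be a complex Hilbert space, $H_0$ a (possibly unbounded) self-adjoint operator in $\mathcal H$ with domain $\mathcal D(H_0)$, and $t\mapsto V(t)$, $t\in\mathbb R$, a strongly continuous family of bounded (not necessarily self-adjoint) operators on $\mathcal H$. Consider $$\frac{d\varphi}{dt}=-i\,(H_0+V(t))\,\varphi+f(t),\qquad f:\mathbb R\to\mathcal H\ \text{continuous and bounded}.\tag{1}$$ A weak solution of (1) on $J\subseteq\mathbb R$ is a function $x$ such that, for every $\eta\in \mathcal D(H_0)$ and every $t\in J$, $(\eta,x(\cdot))$ is differentiable at $t$ with $$\tfrac{d}{dt}(\eta,x(t))=-i(H_0\eta,x(t))-i(\eta,V(t)x(t))+(\eta,f(t)).$$ Let $U(t,s)=e^{-itH_0}\tilde U(t,s)e^{isH_0}$, $t,s\in\mathbb R$, be the evolution family of the homogeneous equation, where $\tilde U(t,s)$ is the sum of the Dyson series of $\tilde V(t)=e^{itH_0}V(t)e^{-itH_0}$. An exponential dichotomy of $U$ on an interval $J$ with bounded projections $P(t)$ ($P(t)^2=P(t)$, not necessarily orthogonal) means: $U(t,s)P(s)=P(t)U(t,s)$ and,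 for some constants $M$ and $\alpha>0$, $$\|U(t,s)P(s)\|\le Me^{-\alpha(t-s)},\qquad \|U(s,t)(I-P(t))\|\le Me^{-\alpha(t-s)},\qquad s\le t,\ s,t\in J.$$ **Theorem.** Suppose that $U$ has an exponential dichotomy on $[0,\infty)$ with projections $P_+(t)$ and on $(-\infty,0]$ with projections $P_-(t)$, and that $D=P_+(0)-(I-P_-(0))$ is generalized-invertible, i.e. $DXD=D$ for some bounded $X$. Let $D^+$ be the Moore–Penrose pseudoinverse of $D$, $\mathcal P_{N(D)}=I-D^+D$, $\mathcal P_{N(D^*)}=I-DD^+$, and $H(t)=\mathcal P_{N(D^*)}P_-(0)U(0,t)$. Put $$g=\int_0^{\infty}U(0,\tau)(I-P_+(\tau))f(\tau)\,d\tau+\int_{-\infty}^0U(0,\tau)P_-(\tau)f(\tau)\,d\tau ,$$ $$(G[f])(t,0)=\int_0^tU(t,\tau)P_+(\tau)f(\tau)\,d\tau-\int_t^{\infty}U(t,\tau)(I-P_+(\tau))f(\tau)\,d\tau+U(t,0)P_+(0)D^+g\quad(t\ge0),$$ $$(G[f])(t,0)=\int_{-\infty}^tU(t,\tau)P_-(\tau)f(\tau)\,d\tau-\int_t^0U(t,\tau)(I-P_-(\tau))f(\tau)\,d\tau+U(t,0)(I-P_-(0))D^+g\quad(t\le0),$$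 where at $t=0$ the first formula is used (by assertion 2 the two formulas agree there under condition (2)). All improper integrals here and below converge absolutely, and the following holds. 1. Equation (1) has a weak solution on $\mathbb R$ that is bounded on $\mathbb R$ if and only if $$\int_{-\infty}^{+\infty}H(t)f(t)\,dt=0.\tag{2}$$ 2. If (2) holds, the weak solutions of (1) on $\mathbb R$ that are bounded on $\mathbb R$ are exactly the functions $$x_0(t,c)=U(t,0)P_+(0)\mathcal P_{N(D)}c+(G[f])(t,0),\qquad c\in\mathcal H;$$ the two formulas for $(G[f])(0,0)$ agree, and $(G[f])(\cdot,0)$ is itself a weak solution of (1) on $\mathbb R$. 3. Whether or not (2) holds, $(G[f])(\cdot,0)$ is a weak solution of (1) on $\mathbb R\setminus\{0\}$, has one-sided limits at $0$, and $$(G[f])(0+,0)-(G[f])(0-,0)=-\int_{-\infty}^{+\infty}H(t)f(t)\,dt .$$ -/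

import Mathlib

open MeasureTheory Filter Topology Set
open scoped BoundedContinuousFunction

noncomputable section

namespace SchrodingerDichotomy

variable {E : Type*} [NormedAddCommGroup E] [InnerProductSpace ℂ E] [CompleteSpace E]

/-- `W t = e^{-itA}`: the strongly continuous one-parameter unitary group whose infinitesimal
generator is exactly `-iA` (domains included).  For self-adjoint `A` it is unique. -/
structure IsUnitaryGroupOf (A : E →ₗ.[ℂ] E) (W : ℝ → E →L[ℂ] E) : Prop where
  unitary : ∀ t, W t ∈ unitary (E →L[ℂ] E)
  map_zero : W 0 = 1
  map_add : ∀ s t, W (s + t) = W s * W t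
  continuous : ∀ ψ, Continuous fun t => W t ψ
  generator : ∀ ψ ψ' : E, HasDerivAt (fun t => W t ψ) ψ' 0 ↔
    ∃ h : ψ ∈ A.domain, ψ' = -Complex.I • A ⟨ψ, h⟩

/-- The perturbation in the interaction picture, `e^{itA} V(t) e^{-itA}`, where `W t = e^{-itA}`. -/
def interaction (W V : ℝ → E →L[ℂ] E) (t : ℝ) : E →L[ℂ] E :=
  W (-t) * V t * W t

/-- The `n`-th term of the Dyson series applied to `ψ`:
`(-i)^n ∫_s^t ∫_s^{t₁} ⋯ ∫_s^{tₙ₋₁} Ṽ(t₁) ⋯ Ṽ(tₙ) ψ dtₙ ⋯ dt₁`. -/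
def dysonTerm (W V : ℝ → E →L[ℂ] E) (s : ℝ) (ψ : E) : ℕ → ℝ → E
  | 0, _ => ψ
  | n + 1, t => -Complex.I • ∫ τ in s..t, interaction W V τ (dysonTerm W V s ψ n τ)

/-- `U(t,s) = e^{-itH₀} Ũ(t,s) e^{isH₀}` for all real `t, s`, where `Ũ` is the Dyson propagator of
`Ṽ(t) = e^{itH₀} V(t) e^{-itH₀}`: the family of evolution operators of `φ' = -i (H₀ + V(t)) φ`. -/
def IsEvolutionFamily (H₀ : E →ₗ.[ℂ] E) (V : ℝ → E →L[ℂ] E) (U : ℝ → ℝ → E →L[ℂ] E) : Prop :=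
  ∃ W : ℝ → E →L[ℂ] E, IsUnitaryGroupOf H₀ W ∧
    ∀ t s ψ, U t s ψ = W t (∑' n, dysonTerm W V s (W (-s) ψ) n t)

/-- `x` satisfies `x' = -i (H₀ + V(t)) x + f(t)` weakly at every point of `J`. -/
def IsWeakSolutionOn (H₀ : E →ₗ.[ℂ] E) (V : ℝ → E →L[ℂ] E) (f : ℝ → E) (x : ℝ → E)
    (J : Set ℝ) : Prop :=
  ∀ η : H₀.domain, ∀ t ∈ J, HasDerivAt (fun τ => inner ℂ (η : E) (x τ))
    (-Complex.I * inner ℂ (H₀ η) (x t) - Complex.I * inner ℂ (η : E) (V t (x t))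
      + inner ℂ (η : E) (f t)) t

/-- A weak solution on the entire line which is bounded there. -/
def IsBoundedWeakSolution (H₀ : E →ₗ.[ℂ] E) (V : ℝ → E →L[ℂ] E) (f : ℝ → E) (x : ℝ → E) :
    Prop :=
  IsWeakSolutionOn H₀ V f x univ ∧ ∃ C : ℝ, ∀ t, ‖x t‖ ≤ C

/-- Exponential dichotomy of `U` on the interval `J` with projections `P t`, `t ∈ J`
(only the values of `P` on `J` matter; the projections need not be orthogonal). -/
structure HasExpDichotomyOn (U : ℝ → ℝ → E →L[ℂ] E) (J : Set ℝ) (P : ℝ → E →L[ℂ] E) :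
    Prop where
  idem : ∀ t ∈ J, P t * P t = P t
  comm : ∀ t ∈ J, ∀ s ∈ J, s ≤ t → U t s * P s = P t * U t s
  bound : ∃ M α : ℝ, 0 < α ∧ ∀ t ∈ J, ∀ s ∈ J, s ≤ t →
    ‖U t s * P s‖ ≤ M * Real.exp (-α * (t - s)) ∧
    ‖U s t * (1 - P t)‖ ≤ M * Real.exp (-α * (t - s))

/-- Existence of a bounded generalized (inner) inverse. -/
def IsGeneralizedInvertible (D : E →L[ℂ] E) : Prop :=
  ∃ X : E →L[ℂ] E, D * X * D = D

/-- The four Penrose equations. -/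
structure IsMoorePenroseInverse (D X : E →L[ℂ] E) : Prop where
  mul_mul : D * X * D = D
  mul_mul' : X * D * X = X
  selfAdjoint_left : IsSelfAdjoint (D * X)
  selfAdjoint_right : IsSelfAdjoint (X * D)

open Classical in
/-- The Moore–Penrose pseudoinverse `D⁺` (the value `0` if there is none). -/
def pinv (D : E →L[ℂ] E) : E →L[ℂ] E :=
  if h : ∃ X, IsMoorePenroseInverse D X then h.choose else 0

/-- `𝒫_{N(D)} = I - D⁺ D`. -/
def projKer (D : E →L[ℂ] E) : E →L[ℂ] E := 1 - pinv D * D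

/-- `𝒫_{N(D*)} = I - D D⁺`. -/
def projCoker (D : E →L[ℂ] E) : E →L[ℂ] E := 1 - D * pinv D

/-- `D = P₊(0) - (I - P₋(0))`. -/
def matchingOp (Pp Pm : ℝ → E →L[ℂ] E) : E →L[ℂ] E := Pp 0 - (1 - Pm 0)

/-- `H(t) = 𝒫_{N(D*)} P₋(0) U(0,t)`. -/
def solvabilityKernel (U : ℝ → ℝ → E →L[ℂ] E) (Pp Pm : ℝ → E →L[ℂ] E) (t : ℝ) : E →L[ℂ] E :=
  projCoker (matchingOp Pp Pm) * Pm 0 * U 0 t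

/-- `∫_s^∞ U(s,τ)(I - P₊(τ)) f(τ) dτ + ∫_{-∞}^s U(s,τ) P₋(τ) f(τ) dτ`. -/
def matchingVector (U : ℝ → ℝ → E →L[ℂ] E) (Pp Pm : ℝ → E →L[ℂ] E) (f : ℝ → E) (s : ℝ) : E :=
  (∫ τ in Ioi s, U s τ ((1 - Pp τ) (f τ))) + ∫ τ in Iic s, U s τ (Pm τ (f τ))

/-- The branch `t ≥ s` of the generalized Green operator. -/
def greenForward (U : ℝ → ℝ → E →L[ℂ] E) (Pp Pm : ℝ → E →L[ℂ] E) (f : ℝ → E) (t s : ℝ) : E :=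
  (∫ τ in s..t, U t τ (Pp τ (f τ))) - (∫ τ in Ioi t, U t τ ((1 - Pp τ) (f τ)))
    + U t s (Pp s (pinv (matchingOp Pp Pm) (matchingVector U Pp Pm f s)))

/-- The branch `t ≤ s` of the generalized Green operator. -/
def greenBackward (U : ℝ → ℝ → E →L[ℂ] E) (Pp Pm : ℝ → E →L[ℂ] E) (f : ℝ → E) (t s : ℝ) : E :=
  (∫ τ in Iic t, U t τ (Pm τ (f τ))) - (∫ τ in t..s, U t τ ((1 - Pm τ) (f τ)))
    + U t s ((1 - Pm s) (pinv (matchingOp Pp Pm) (matchingVector U Pp Pm f s)))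

/-- The generalized Green operator `(G[f])(t,s)`. -/
def green (U : ℝ → ℝ → E →L[ℂ] E) (Pp Pm : ℝ → E →L[ℂ] E) (f : ℝ → E) (t s : ℝ) : E :=
  if s ≤ t then greenForward U Pp Pm f t s else greenBackward U Pp Pm f t s

end SchrodingerDichotomy

end

/-!
In the interaction picture `y(t) = e^{itH₀} x(t)` the unbounded part of the equation disappears, so
a locally bounded weak solution becomes a classical solution of a linear equation with strongly
continuous bounded coefficients. Hence it is the mild solution
`x(t) = U(t,s) x(s) + ∫_s^t U(t,τ) f(τ) dτ`.

On `[0,∞)` the dichotomy makes the stable component of a mild solution bounded automatically, while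
`U(0,t)(I - P₊(t))` decays. So the solution is bounded exactly when the unstable component of `x(0)`
is `-∫_0^∞ U(0,τ)(I - P₊(τ)) f(τ) dτ`. Reversing time, boundedness on `(-∞,0]` prescribes the stable
component of `x(0)` instead. Both conditions hold for some `x(0)` if and only if `D v = g` is
solvable, that is `𝒫_{N(D*)} g = 0`, and the pseudoinverse parametrizes the solutions `v`. Since
`𝒫_{N(D*)} D = 0`, the operators `P₋(0)` and `I - P₊(0)` agree after applying `𝒫_{N(D*)}`, which
turns `𝒫_{N(D*)} g` into `∫ H(t) f(t) dt`.
-/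

open scoped InnerProductSpace

noncomputable section

namespace SchrodingerDichotomy

section StronglyContinuous

variable {𝕜 E F X : Type*} [NontriviallyNormedField 𝕜]
  [NormedAddCommGroup E] [NormedSpace 𝕜 E] [NormedAddCommGroup F] [NormedSpace 𝕜 F]

/-- Continuity of an operator family for the strong operator topology, i.e. pointwise. -/
def IsStronglyContinuous [TopologicalSpace X] (B : X → E →L[𝕜] F) : Prop :=
  ∀ v, Continuous fun x => B x v

theorem tendsto_clm_apply_of_isBoundedUnder {l : Filter X} {B : X → E →L[𝕜] F} {g : X → E}
    {w : E} {z : F} (hb : l.IsBoundedUnder (· ≤ ·) fun x => ‖B x‖)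
    (hB : Tendsto (fun x => B x w) l (𝓝 z)) (hg : Tendsto g l (𝓝 w)) :
    Tendsto (fun x => B x (g x)) l (𝓝 z) := by
  have hg0 : Tendsto (fun x => g x - w) l (𝓝 0) := tendsto_sub_nhds_zero_iff.2 hg
  have hdiff : Tendsto (fun x => B x (g x - w)) l (𝓝 0) :=
    hg0.op_zero_isBoundedUnder_le hb (fun v A => A v)
      fun v A => (A.le_opNorm v).trans_eq (mul_comm _ _)
  simpa only [map_sub, sub_add_cancel, zero_add] using hdiff.add hB

theorem continuousAt_clm_apply_of_dense [TopologicalSpace X] {B : X → E →L[𝕜] F} {x : X}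
    {S : Set E} (hS : Dense S) (hb : (𝓝 x).IsBoundedUnder (· ≤ ·) fun y => ‖B y‖)
    (hB : ∀ v ∈ S, ContinuousAt (fun y => B y v) x) (w : E) : ContinuousAt (fun y => B y w) x := by
  obtain ⟨C, hC⟩ := hb.eventually_le
  refine continuousAt_of_locally_uniform_approx_of_continuousAt fun u hu => ?_
  obtain ⟨ε, hε, hu⟩ := Metric.mem_uniformity_dist.1 hu
  obtain ⟨v, hv, hvw⟩ := hS.exists_dist_lt w (show 0 < ε / (|C| + 1) by positivity)
  refine ⟨_, hC, fun y => B y v, hB v hv, fun y hy => hu ?_⟩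
  rw [dist_eq_norm, lt_div_iff₀ (by positivity)] at hvw
  rw [dist_eq_norm, ← map_sub]
  calc ‖B y (w - v)‖ ≤ C * ‖w - v‖ := (B y).le_of_opNorm_le hy _
    _ ≤ ‖w - v‖ * (|C| + 1) := by
      rw [mul_comm]
      gcongr
      exact (le_abs_self C).trans (lt_add_one _).le
    _ < ε := hvw

theorem hasDerivAt_clm_apply {E F : Type*} [NormedAddCommGroup E] [NormedSpace ℝ E]
    [NormedSpace 𝕜 E] [NormedAddCommGroup F] [NormedSpace ℝ F] [NormedSpace 𝕜 F]
    [LinearMap.CompatibleSMul E F ℝ 𝕜] {B : ℝ → E →L[𝕜] F} {w : ℝ → E} {w' : E} {d : F} {t : ℝ}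
    (hb : (𝓝 t).IsBoundedUnder (· ≤ ·) fun τ => ‖B τ‖) (hB : ContinuousAt (fun τ => B τ w') t)
    (hd : HasDerivAt (fun τ => B τ (w t)) d t) (hw : HasDerivAt w w' t) :
    HasDerivAt (fun τ => B τ (w τ)) (d + B t w') t := by
  rw [hasDerivAt_iff_tendsto_slope] at *
  have hslope : Tendsto (fun τ => B τ (slope w t τ)) (𝓝[≠] t) (𝓝 (B t w')) :=
    tendsto_clm_apply_of_isBoundedUnder (hb.mono nhdsWithin_le_nhds)
      (hB.tendsto.mono_left nhdsWithin_le_nhds) hw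
  refine (hd.add hslope).congr fun τ => ?_
  simp only [slope_def_module, ContinuousLinearMap.map_smul_of_tower, map_sub, ← smul_add]
  congr 1
  abel

namespace IsStronglyContinuous

variable [TopologicalSpace X] [CompleteSpace E] {B : X → E →L[𝕜] F}

theorem exists_bound_of_isCompact (hB : IsStronglyContinuous B) {K : Set X} (hK : IsCompact K) :
    ∃ C, 0 ≤ C ∧ ∀ x ∈ K, ‖B x‖ ≤ C := by
  obtain ⟨C, hC⟩ := banach_steinhaus (g := fun x : K => B x) fun v =>
    have ⟨C, hC⟩ := hK.exists_bound_of_continuousOn (hB v).continuousOn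
    ⟨C, fun x => hC x x.2⟩
  exact ⟨max C 0, le_max_right _ _, fun x hx => (hC ⟨x, hx⟩).trans (le_max_left _ _)⟩

variable [WeaklyLocallyCompactSpace X]

theorem isBoundedUnder_norm (hB : IsStronglyContinuous B) (x : X) :
    (𝓝 x).IsBoundedUnder (· ≤ ·) fun y => ‖B y‖ := by
  obtain ⟨K, hK, hxK⟩ := exists_compact_mem_nhds x
  obtain ⟨C, -, hC⟩ := hB.exists_bound_of_isCompact hK
  exact isBoundedUnder_of_eventually_le (eventually_of_mem hxK hC)

theorem continuous_apply (hB : IsStronglyContinuous B) {g : X → E} (hg : Continuous g) :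
    Continuous fun x => B x (g x) :=
  continuous_iff_continuousAt.2 fun x =>
    tendsto_clm_apply_of_isBoundedUnder (hB.isBoundedUnder_norm x) (hB (g x)).continuousAt
      hg.continuousAt

theorem mul {A B : X → E →L[𝕜] E} (hA : IsStronglyContinuous A) (hB : IsStronglyContinuous B) :
    IsStronglyContinuous fun x => A x * B x :=
  fun v => hA.continuous_apply (hB v)

end IsStronglyContinuous

end StronglyContinuous

section MoorePenrose

variable {E : Type*} [NormedAddCommGroup E] [InnerProductSpace ℂ E] [CompleteSpace E]

theorem exists_isSelfAdjoint_mul_eq_of_isIdempotentElem {e : E →L[ℂ] E}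
    (he : IsIdempotentElem e) : ∃ q, IsSelfAdjoint q ∧ e * q = q ∧ q * e = e := by
  have : CompleteSpace e.range :=
    (ContinuousLinearMap.IsIdempotentElem.isClosed_range he).completeSpace_coe
  refine ⟨e.range.starProjection, isSelfAdjoint_starProjection _, ?_, ?_⟩ <;> ext v
  · obtain ⟨w, hw⟩ := e.range.starProjection_apply_mem v
    change e (e.range.starProjection v) = _
    rw [← hw]
    exact congrArg (· w) he
  · exact Submodule.starProjection_eq_self_iff.2 ⟨v, rfl⟩

theorem isMoorePenroseInverse_mul_mul {D X q r : E →L[ℂ] E} (hq : IsSelfAdjoint q)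
    (hr : IsSelfAdjoint r) (hDXq : D * X * q = q) (hqD : q * D = D) (hDr : D * r = D)
    (hrXD : r * X * D = r) : IsMoorePenroseInverse D (r * X * q) := by
  have hleft : D * (r * X * q) = q := by rw [← mul_assoc, ← mul_assoc, hDr, hDXq]
  have hright : r * X * q * D = r := by rw [mul_assoc, hqD, hrXD]
  have hrr : r * r = r := by
    calc r * r = r * X * D * r := by rw [hrXD]
      _ = r := by rw [mul_assoc, hDr, hrXD]
  refine ⟨by rw [hleft, hqD], ?_, by rwa [hleft], by rwa [hright]⟩
  rw [hright, ← mul_assoc, ← mul_assoc, hrr]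

theorem IsGeneralizedInvertible.exists_isMoorePenroseInverse {D : E →L[ℂ] E}
    (hD : IsGeneralizedInvertible D) : ∃ X, IsMoorePenroseInverse D X := by
  obtain ⟨X, hX⟩ := hD
  have hDX : IsIdempotentElem (D * X) := by rw [IsIdempotentElem, ← mul_assoc, hX]
  have hXD : IsIdempotentElem (X * D) := by rw [IsIdempotentElem, mul_assoc, ← mul_assoc D, hX]
  -- `q` and `1 - n` are the orthogonal projections onto the range of `D` and onto `N(D)ᗮ`.
  obtain ⟨q, hq, hDXq, hqDX⟩ := exists_isSelfAdjoint_mul_eq_of_isIdempotentElem hDX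
  obtain ⟨n, hn, hXDn, hnXD⟩ := exists_isSelfAdjoint_mul_eq_of_isIdempotentElem hXD.one_sub
  have hDn : D * n = 0 := by
    rw [← hXDn, ← mul_assoc, mul_sub, mul_one, ← mul_assoc, hX, sub_self, zero_mul]
  refine ⟨_, isMoorePenroseInverse_mul_mul hq ((IsSelfAdjoint.one _).sub hn) hDXq ?_ ?_ ?_⟩
  · rw [← hX, ← mul_assoc, hqDX]
  · rw [mul_sub, mul_one, hDn, sub_zero]
  · rw [mul_sub, mul_one] at hnXD
    rw [sub_mul, sub_mul, one_mul, mul_assoc, sub_eq_sub_iff_add_eq_add, add_comm (X * D),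
      ← sub_eq_sub_iff_add_eq_add, hnXD]

namespace IsGeneralizedInvertible

variable {D : E →L[ℂ] E}

theorem isMoorePenroseInverse_pinv (hD : IsGeneralizedInvertible D) :
    IsMoorePenroseInverse D (pinv D) := by
  rw [pinv, dif_pos hD.exists_isMoorePenroseInverse]
  exact hD.exists_isMoorePenroseInverse.choose_spec

theorem apply_pinv_apply (hD : IsGeneralizedInvertible D) (v : E) : D (pinv D (D v)) = D v :=
  congrArg (· v) hD.isMoorePenroseInverse_pinv.mul_mul

theorem projCoker_apply_apply (hD : IsGeneralizedInvertible D) (v : E) :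
    projCoker D (D v) = 0 :=
  sub_eq_zero.2 (hD.apply_pinv_apply v).symm

theorem apply_projKer (hD : IsGeneralizedInvertible D) (c : E) : D (projKer D c) = 0 :=
  (map_sub D c _).trans (sub_eq_zero.2 (hD.apply_pinv_apply c).symm)

theorem exists_apply_eq_iff (hD : IsGeneralizedInvertible D) {g : E} :
    (∃ v, D v = g) ↔ projCoker D g = 0 := by
  refine ⟨?_, fun hg => ⟨pinv D g, (sub_eq_zero.1 hg).symm⟩⟩
  rintro ⟨v, rfl⟩
  exact hD.projCoker_apply_apply v

theorem apply_eq_iff_of_projCoker_eq_zero (hD : IsGeneralizedInvertible D) {g v : E}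
    (hg : projCoker D g = 0) : D v = g ↔ ∃ c, v = projKer D c + pinv D g := by
  constructor
  · rintro rfl
    exact ⟨v, (sub_add_cancel v _).symm⟩
  · rintro ⟨c, rfl⟩
    rw [map_add, hD.apply_projKer, zero_add]
    exact (sub_eq_zero.1 hg).symm

end IsGeneralizedInvertible

end MoorePenrose

section LinearODE

theorem exists_mem_Ioo_and_mem_Ioo {α : Type*} [LinearOrder α] [NoMinOrder α] [NoMaxOrder α]
    (s t : α) : ∃ a b, s ∈ Ioo a b ∧ t ∈ Ioo a b :=
  have ⟨a, ha⟩ := exists_lt (min s t)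
  have ⟨b, hb⟩ := exists_gt (max s t)
  ⟨a, b, ⟨(lt_min_iff.1 ha).1, (max_lt_iff.1 hb).1⟩, (lt_min_iff.1 ha).2, (max_lt_iff.1 hb).2⟩

variable {𝕜 E : Type*} [NontriviallyNormedField 𝕜] [NormedAddCommGroup E] [NormedSpace 𝕜 E]
  [NormedSpace ℝ E] [CompleteSpace E]

theorem linearODE_solution_unique {N : ℝ → E →L[𝕜] E} (hN : IsStronglyContinuous N)
    {g y z : ℝ → E} (hy : ∀ t, HasDerivAt y (N t (y t) + g t) t)
    (hz : ∀ t, HasDerivAt z (N t (z t) + g t) t) {t₀ : ℝ} (h₀ : y t₀ = z t₀) : y = z := by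
  funext t
  obtain ⟨a, b, ht, ht₀⟩ := exists_mem_Ioo_and_mem_Ioo t t₀
  obtain ⟨C, hC0, hC⟩ := hN.exists_bound_of_isCompact (isCompact_Icc (a := a) (b := b))
  refine ODE_solution_unique_of_mem_Ioo (v := fun τ x => N τ x + g τ) (s := fun _ => univ)
    (K := ⟨C, hC0⟩) (fun τ hτ => ?_) ht₀ (fun τ _ => ⟨hy τ, trivial⟩)
    (fun τ _ => ⟨hz τ, trivial⟩) h₀ ht
  refine LipschitzOnWith.of_dist_le_mul fun u _ v _ => ?_
  rw [dist_add_right, dist_eq_norm, dist_eq_norm, ← map_sub]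
  exact (N τ).le_of_opNorm_le (hC τ (Ioo_subset_Icc_self hτ)) _

end LinearODE

section WeakDerivative

variable {E : Type*} [NormedAddCommGroup E] [InnerProductSpace ℂ E] {S : Set E}

theorem norm_le_of_forall_mem_norm_inner_le (hS : Dense S) {z : E} {C : ℝ} (hC : 0 ≤ C)
    (h : ∀ η ∈ S, ‖⟪η, z⟫_ℂ‖ ≤ C * ‖η‖) : ‖z‖ ≤ C := by
  have hclosed : IsClosed {v : E | ‖⟪v, z⟫_ℂ‖ ≤ C * ‖v‖} :=
    isClosed_le (by fun_prop) (by fun_prop)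
  have hz : ‖⟪z, z⟫_ℂ‖ ≤ C * ‖z‖ := hclosed.closure_subset_iff.2 h (hS z)
  rw [inner_self_eq_norm_sq_to_K, norm_pow, RCLike.norm_ofReal, abs_norm, sq] at hz
  rcases (norm_nonneg z).eq_or_lt with h0 | h0
  · exact h0 ▸ hC
  · exact le_of_mul_le_mul_right hz h0

theorem norm_image_sub_le_of_hasDerivWithinAt_inner (hS : Dense S) {s : Set ℝ} (hs : Convex ℝ s)
    {y z : ℝ → E} {C : ℝ}
    (hy : ∀ η ∈ S, ∀ t ∈ s, HasDerivWithinAt (fun τ => ⟪η, y τ⟫_ℂ) ⟪η, z t⟫_ℂ s t)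
    (hz : ∀ t ∈ s, ‖z t‖ ≤ C) {a b : ℝ} (ha : a ∈ s) (hb : b ∈ s) :
    ‖y b - y a‖ ≤ C * ‖b - a‖ := by
  have hC : 0 ≤ C := (norm_nonneg _).trans (hz a ha)
  refine norm_le_of_forall_mem_norm_inner_le hS (by positivity) fun η hη => ?_
  rw [inner_sub_right, mul_right_comm]
  refine hs.norm_image_sub_le_of_norm_hasDerivWithin_le (hy η hη) (fun t ht => ?_) ha hb
  rw [mul_comm]
  exact (norm_inner_le_norm _ _).trans (by gcongr; exact hz t ht)

variable {y z : ℝ → E} {t : ℝ}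

theorem continuousAt_of_hasDerivAt_inner (hS : Dense S)
    (hy : ∀ η ∈ S, ∀ τ, HasDerivAt (fun r => ⟪η, y r⟫_ℂ) ⟪η, z τ⟫_ℂ τ)
    (hz : (𝓝 t).IsBoundedUnder (· ≤ ·) fun τ => ‖z τ‖) : ContinuousAt y t := by
  obtain ⟨C, hC⟩ := hz.eventually_le
  obtain ⟨ε, hε, hC⟩ := Metric.eventually_nhds_iff_ball.1 hC
  refine tendsto_iff_norm_sub_tendsto_zero.2 (squeeze_zero' (.of_forall fun _ => norm_nonneg _)
    (g := fun r => C * ‖r - t‖) ?_ (by simpa using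
      (by fun_prop : Continuous fun r => C * ‖r - t‖).tendsto t))
  filter_upwards [Metric.ball_mem_nhds t hε] with r hr
  exact norm_image_sub_le_of_hasDerivWithinAt_inner hS (convex_ball t ε)
    (fun η hη τ _ => (hy η hη τ).hasDerivWithinAt) hC (Metric.mem_ball_self hε) hr

theorem hasDerivAt_of_hasDerivAt_inner (hS : Dense S)
    (hy : ∀ η ∈ S, ∀ τ, HasDerivAt (fun r => ⟪η, y r⟫_ℂ) ⟪η, z τ⟫_ℂ τ)
    (hz : ContinuousAt z t) : HasDerivAt y (z t) t := by
  rw [hasDerivAt_iff_isLittleO, Asymptotics.isLittleO_iff]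
  intro c hc
  obtain ⟨ε, hε, hzc⟩ := Metric.continuousAt_iff.1 hz c hc
  have hsub : ∀ η ∈ S, ∀ τ,
      HasDerivAt (fun r => ⟪η, y r - (r - t) • z t⟫_ℂ) ⟪η, z τ - z t⟫_ℂ τ := fun η hη τ => by
    have hlin : HasDerivAt (fun r => (r - t) • z t) (z t) τ := by
      simpa using ((hasDerivAt_id τ).sub_const t).smul_const (z t)
    simpa only [inner_sub_right, inner_zero_left, add_zero] using
      (hy η hη τ).fun_sub ((hasDerivAt_const τ η).inner ℂ hlin)
  filter_upwards [Metric.ball_mem_nhds t hε] with r hr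
  have := norm_image_sub_le_of_hasDerivWithinAt_inner hS (convex_ball t ε)
    (fun η hη τ _ => (hsub η hη τ).hasDerivWithinAt)
    (fun τ hτ => (dist_eq_norm (z τ) (z t) ▸ hzc hτ).le) (Metric.mem_ball_self hε) hr
  simpa [sub_right_comm] using this

end WeakDerivative

variable {E : Type*} [NormedAddCommGroup E] [InnerProductSpace ℂ E] {W V : ℝ → E →L[ℂ] E}

section Dyson

/-- The generator `-i Ṽ(t)` of the interaction-picture equation `y' = -i Ṽ(t) y`, whose solutions
are `y(t) = e^{itH₀} φ(t)`. -/
def interactionGenerator (W V : ℝ → E →L[ℂ] E) (t : ℝ) : E →L[ℂ] E :=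
  -Complex.I • interaction W V t

theorem interactionGenerator_apply (W V : ℝ → E →L[ℂ] E) (t : ℝ) (v : E) :
    interactionGenerator W V t v = -Complex.I • W (-t) (V t (W t v)) := rfl

theorem isStronglyContinuous_interactionGenerator (hI : IsStronglyContinuous (interaction W V)) :
    IsStronglyContinuous (interactionGenerator W V) :=
  fun v => (hI v).const_smul _

theorem tsum_dysonTerm_self (s : ℝ) (ψ : E) : ∑' n, dysonTerm W V s ψ n s = ψ := by
  rw [tsum_eq_single 0 fun n hn => ?_]
  · rfl
  · obtain ⟨n, rfl⟩ := Nat.exists_eq_succ_of_ne_zero hn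
    rw [dysonTerm, intervalIntegral.integral_same, smul_zero]

theorem norm_dysonTerm_le {K : Set ℝ} {C s t : ℝ} (hK : K.OrdConnected)
    (hC : ∀ t ∈ K, ‖interaction W V t‖ ≤ C) (hs : s ∈ K) (ht : t ∈ K) (ψ : E) (n : ℕ) :
    ‖dysonTerm W V s ψ n t‖ ≤ (C * |t - s|) ^ n / n.factorial * ‖ψ‖ := by
  have hC0 : 0 ≤ C := (norm_nonneg _).trans (hC s hs)
  induction n generalizing t with
  | zero => simp [dysonTerm]
  | succ n ih =>
    have hint : ‖∫ τ in s..t, interaction W V τ (dysonTerm W V s ψ n τ)‖ ≤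
        |∫ τ in s..t, C * (C ^ n / n.factorial * ‖ψ‖) * |τ - s| ^ n| := by
      refine intervalIntegral.norm_integral_le_abs_of_norm_le
        ((ae_restrict_mem measurableSet_uIoc).mono fun τ hτ => ?_)
        (Continuous.intervalIntegrable (by fun_prop) _ _)
      have hτK : τ ∈ K := hK.uIcc_subset hs ht (uIoc_subset_uIcc hτ)
      refine ((interaction W V τ).le_of_opNorm_le_of_le (hC τ hτK) (ih hτK)).trans_eq ?_
      ring
    rw [dysonTerm, norm_smul, norm_neg, Complex.norm_I, one_mul]
    refine hint.trans_eq ?_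
    rw [intervalIntegral.integral_const_mul, abs_mul, intervalIntegral.abs_intervalIntegral_eq,
      integral_pow_abs_sub_uIoc, abs_of_nonneg (by positivity), abs_of_nonneg (by positivity),
      mul_pow, Nat.factorial_succ]
    push_cast
    field_simp
    ring

theorem norm_tsum_dysonTerm_le {K : Set ℝ} {C s t : ℝ} (hK : K.OrdConnected)
    (hC : ∀ t ∈ K, ‖interaction W V t‖ ≤ C) (hs : s ∈ K) (ht : t ∈ K) (ψ : E) :
    ‖∑' n, dysonTerm W V s ψ n t‖ ≤ Real.exp (C * |t - s|) * ‖ψ‖ := by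
  rw [Real.exp_eq_exp_ℝ]
  exact tsum_of_norm_bounded ((NormedSpace.expSeries_div_hasSum_exp (C * |t - s|)).mul_right ‖ψ‖)
    (norm_dysonTerm_le hK hC hs ht ψ)

variable [CompleteSpace E]

theorem hasDerivAt_dysonTerm_succ (hI : IsStronglyContinuous (interaction W V)) {s : ℝ} {ψ : E}
    {n : ℕ} (hn : Continuous (dysonTerm W V s ψ n)) (t : ℝ) :
    HasDerivAt (dysonTerm W V s ψ (n + 1))
      (interactionGenerator W V t (dysonTerm W V s ψ n t)) t :=
  ((hI.continuous_apply hn).integral_hasStrictDerivAt s t).hasDerivAt.const_smul (-Complex.I)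

theorem continuous_dysonTerm (hI : IsStronglyContinuous (interaction W V)) (s : ℝ) (ψ : E) (n : ℕ) :
    Continuous (dysonTerm W V s ψ n) := by
  induction n with
  | zero => exact continuous_const
  | succ n ih =>
    exact continuous_iff_continuousAt.2 fun t => (hasDerivAt_dysonTerm_succ hI ih t).continuousAt

theorem summable_dysonTerm (hI : IsStronglyContinuous (interaction W V)) (s : ℝ) (ψ : E) (t : ℝ) :
    Summable fun n => dysonTerm W V s ψ n t := by
  obtain ⟨C, -, hC⟩ := hI.exists_bound_of_isCompact (isCompact_uIcc (a := s) (b := t))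
  exact .of_norm_bounded ((Real.summable_pow_div_factorial _).mul_right ‖ψ‖)
    (norm_dysonTerm_le ordConnected_uIcc hC left_mem_uIcc right_mem_uIcc ψ)

theorem hasDerivAt_tsum_dysonTerm (hI : IsStronglyContinuous (interaction W V)) (s : ℝ) (ψ : E)
    (t : ℝ) : HasDerivAt (fun t => ∑' n, dysonTerm W V s ψ n t)
      (interactionGenerator W V t (∑' n, dysonTerm W V s ψ n t)) t := by
  obtain ⟨a, b, hs, ht⟩ := exists_mem_Ioo_and_mem_Ioo s t
  obtain ⟨C, hC0, hC⟩ := hI.exists_bound_of_isCompact (isCompact_Icc (a := a) (b := b))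
  have hbound : ∀ n, ∀ r ∈ Ioo a b, ‖interactionGenerator W V r (dysonTerm W V s ψ n r)‖ ≤
      C * ((C * (b - a)) ^ n / n.factorial * ‖ψ‖) := fun n r hr => by
    have hr' := Ioo_subset_Icc_self hr
    have hrs : |r - s| ≤ b - a := abs_sub_le_of_le_of_le hr.1.le hr.2.le hs.1.le hs.2.le
    refine ContinuousLinearMap.le_of_opNorm_le_of_le _ ?_ ((norm_dysonTerm_le ordConnected_Icc hC
      (Ioo_subset_Icc_self hs) hr' ψ n).trans (by gcongr))
    rw [interactionGenerator, norm_smul, norm_neg, Complex.norm_I, one_mul]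
    exact hC r hr'
  have hderiv := hasDerivAt_tsum_of_isPreconnected
    (((Real.summable_pow_div_factorial (C * (b - a))).mul_right ‖ψ‖).mul_left C)
    isOpen_Ioo isPreconnected_Ioo
    (fun n r _ => hasDerivAt_dysonTerm_succ hI (continuous_dysonTerm hI s ψ n) r) hbound
    hs ((summable_nat_add_iff 1).2 (summable_dysonTerm hI s ψ s)) ht
  rw [← (interactionGenerator W V t).map_tsum (summable_dysonTerm hI s ψ t)] at hderiv
  exact (hderiv.const_add ψ).congr_of_eventuallyEq
    (.of_forall fun r => (summable_dysonTerm hI s ψ r).tsum_eq_zero_add)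

end Dyson

variable [CompleteSpace E] {H₀ : E →ₗ.[ℂ] E}

namespace IsUnitaryGroupOf

theorem apply_add (hW : IsUnitaryGroupOf H₀ W) (s t : ℝ) (v : E) : W (s + t) v = W s (W t v) :=
  congrArg (· v) (hW.map_add s t)

theorem apply_neg_apply (hW : IsUnitaryGroupOf H₀ W) (t : ℝ) (v : E) : W t (W (-t) v) = v := by
  rw [← hW.apply_add, add_neg_cancel, hW.map_zero, one_apply_eq_self]

theorem neg_apply_apply (hW : IsUnitaryGroupOf H₀ W) (t : ℝ) (v : E) : W (-t) (W t v) = v := by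
  rw [← hW.apply_add, neg_add_cancel, hW.map_zero, one_apply_eq_self]

theorem norm_apply (hW : IsUnitaryGroupOf H₀ W) (t : ℝ) (v : E) : ‖W t v‖ = ‖v‖ :=
  ContinuousLinearMap.norm_map_of_mem_unitary (hW.unitary t) v

theorem inner_apply_apply (hW : IsUnitaryGroupOf H₀ W) (t : ℝ) (u v : E) :
    ⟪W t u, W t v⟫_ℂ = ⟪u, v⟫_ℂ :=
  ContinuousLinearMap.inner_map_map_of_mem_unitary (hW.unitary t) u v

theorem inner_apply_left (hW : IsUnitaryGroupOf H₀ W) (t : ℝ) (u v : E) :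
    ⟪W t u, v⟫_ℂ = ⟪u, W (-t) v⟫_ℂ := by
  rw [← hW.inner_apply_apply t u, hW.apply_neg_apply]

theorem isStronglyContinuous (hW : IsUnitaryGroupOf H₀ W) : IsStronglyContinuous W :=
  hW.continuous

theorem isStronglyContinuous_neg (hW : IsUnitaryGroupOf H₀ W) :
    IsStronglyContinuous fun t => W (-t) :=
  fun v => (hW.continuous v).comp continuous_neg

theorem isStronglyContinuous_interaction (hW : IsUnitaryGroupOf H₀ W)
    (hV : IsStronglyContinuous V) : IsStronglyContinuous (interaction W V) :=
  (hW.isStronglyContinuous_neg.mul hV).mul hW.isStronglyContinuous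

theorem hasDerivAt_apply_apply_zero (hW : IsUnitaryGroupOf H₀ W) (t : ℝ) (η : H₀.domain) :
    HasDerivAt (fun τ => W t (W τ (η : E))) (-Complex.I • W t (H₀ η)) 0 := by
  have h := ((W t).restrictScalars ℝ).hasFDerivAt.comp_hasDerivAt 0
    ((hW.generator η _).2 ⟨η.2, rfl⟩)
  simpa only [ContinuousLinearMap.coe_restrictScalars', map_smul, Function.comp_def] using h

theorem hasDerivAt (hW : IsUnitaryGroupOf H₀ W) (t : ℝ) (η : H₀.domain) :
    HasDerivAt (fun τ => W τ (η : E)) (-Complex.I • W t (H₀ η)) t := by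
  have h := hW.hasDerivAt_apply_apply_zero t η
  rw [← sub_self t] at h
  simpa only [← hW.apply_add, add_sub_cancel] using h.comp_sub_const t t

theorem hasDerivAt_neg (hW : IsUnitaryGroupOf H₀ W) (t : ℝ) (η : H₀.domain) :
    HasDerivAt (fun τ => W (-τ) (η : E)) (Complex.I • W (-t) (H₀ η)) t := by
  simpa only [neg_smul, one_smul, neg_neg, Function.comp_def] using
    (hW.hasDerivAt (-t) η).scomp t (_root_.hasDerivAt_neg t)

theorem apply_mem_domain (hW : IsUnitaryGroupOf H₀ W) (t : ℝ) (η : H₀.domain) :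
    ∃ h : W t (η : E) ∈ H₀.domain, H₀ ⟨W t η, h⟩ = W t (H₀ η) := by
  have hderiv : HasDerivAt (fun τ => W τ (W t (η : E))) (-Complex.I • W t (H₀ η)) 0 := by
    simpa only [← hW.apply_add, add_comm t] using hW.hasDerivAt_apply_apply_zero t η
  obtain ⟨hmem, heq⟩ := (hW.generator _ _).1 hderiv
  exact ⟨hmem, (smul_right_injective E (neg_ne_zero.2 Complex.I_ne_zero) heq).symm⟩

end IsUnitaryGroupOf

section ReversibleEvolution

variable {E : Type*} [NormedAddCommGroup E] [NormedSpace ℂ E]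

/-- A strongly continuous evolution family of bounded operators defined for all pairs of times, so
that `U s t` is the inverse of `U t s`. -/
structure IsReversibleEvolution (U : ℝ → ℝ → E →L[ℂ] E) : Prop where
  map_self : ∀ t, U t t = 1
  map_mul : ∀ t r s, U t r * U r s = U t s
  continuous_left : ∀ s, IsStronglyContinuous fun t => U t s
  continuous_right : ∀ t, IsStronglyContinuous fun s => U t s

/-- The variation of constants formula for `φ' = A(t) φ + f(t)`, `φ(s) = a`, where `U` is the
evolution family of the homogeneous equation. -/
def mildSolution (U : ℝ → ℝ → E →L[ℂ] E) (f : ℝ → E) (s : ℝ) (a : E) (t : ℝ) : E :=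
  U t s a + ∫ τ in s..t, U t τ (f τ)

theorem isStronglyContinuous_right_of_isBoundedUnder {U : ℝ → ℝ → E →L[ℂ] E}
    (hself : ∀ t, U t t = 1) (hmul : ∀ t r s, U t r * U r s = U t s)
    (hleft : ∀ s, IsStronglyContinuous fun t => U t s) {t : ℝ}
    (hb : ∀ s, (𝓝 s).IsBoundedUnder (· ≤ ·) fun r => ‖U t r‖) :
    IsStronglyContinuous fun s => U t s := by
  refine fun v => continuous_iff_continuousAt.2 fun s => ?_
  have hdiff : Tendsto (fun r => v - U r s v) (𝓝 s) (𝓝 0) := by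
    simpa [hself] using ((hleft s v).tendsto s).const_sub v
  have hsplit : ∀ r, U t r (v - U r s v) + U t s v = U t r v := fun r => by
    rw [map_sub, ← hmul t r s, mul_apply_eq_comp, sub_add_cancel]
  have hzero := tendsto_clm_apply_of_isBoundedUnder (hb s)
    (by simpa only [map_zero] using tendsto_const_nhds) hdiff
  simpa only [ContinuousAt, hsplit, zero_add] using hzero.add_const (U t s v)

namespace IsReversibleEvolution

variable {U : ℝ → ℝ → E →L[ℂ] E}

theorem apply_self (hU : IsReversibleEvolution U) (t : ℝ) (v : E) : U t t v = v :=
  congrArg (· v) (hU.map_self t)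

theorem apply_apply (hU : IsReversibleEvolution U) (t r s : ℝ) (v : E) :
    U t r (U r s v) = U t s v :=
  congrArg (· v) (hU.map_mul t r s)

variable {f : ℝ → E}

theorem mildSolution_self (hU : IsReversibleEvolution U) (s : ℝ) (a : E) :
    mildSolution U f s a s = a := by
  rw [mildSolution, hU.apply_self, intervalIntegral.integral_same, add_zero]

variable [CompleteSpace E]

theorem continuous_apply (hU : IsReversibleEvolution U) (hf : Continuous f) (t : ℝ) :
    Continuous fun τ => U t τ (f τ) :=
  (hU.continuous_right t).continuous_apply hf

theorem mildSolution_eq_apply (hU : IsReversibleEvolution U) (hf : Continuous f) (s : ℝ) (a : E)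
    (t : ℝ) : mildSolution U f s a t = U t s (a + ∫ τ in s..t, U s τ (f τ)) := by
  rw [map_add, ← (U t s).intervalIntegral_comp_comm
    ((hU.continuous_apply hf s).intervalIntegrable _ _)]
  simp only [hU.apply_apply, mildSolution]

theorem hasDerivAt_primitive (hU : IsReversibleEvolution U) (hf : Continuous f) (s : ℝ) (a : E)
    (t : ℝ) : HasDerivAt (fun t => a + ∫ τ in s..t, U s τ (f τ)) (U s t (f t)) t :=
  ((hU.continuous_apply hf s).integral_hasStrictDerivAt s t).hasDerivAt.const_add a

theorem continuous_mildSolution (hU : IsReversibleEvolution U) (hf : Continuous f) (s : ℝ)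
    (a : E) : Continuous (mildSolution U f s a) := by
  simp only [funext (hU.mildSolution_eq_apply hf s a)]
  exact (hU.continuous_left s).continuous_apply
    (continuous_iff_continuousAt.2 fun t => (hU.hasDerivAt_primitive hf s a t).continuousAt)

end IsReversibleEvolution

end ReversibleEvolution

section EvolutionFamily

variable {E : Type*} [NormedAddCommGroup E] [InnerProductSpace ℂ E]
  {H₀ : E →ₗ.[ℂ] E} {W V : ℝ → E →L[ℂ] E} {U : ℝ → ℝ → E →L[ℂ] E}

/-- `e^{itH₀} U(t,s) ψ`, where `W t = e^{-itH₀}`, solves the interaction-picture equation for every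
initial time `s` and initial state `ψ`: `U` propagates `φ' = -i (H₀ + V(t)) φ`. -/
def SolvesInteractionEquation (W V : ℝ → E →L[ℂ] E) (U : ℝ → ℝ → E →L[ℂ] E) : Prop :=
  ∀ s ψ t, HasDerivAt (fun τ => W (-τ) (U τ s ψ))
    (interactionGenerator W V t (W (-t) (U t s ψ))) t

theorem SolvesInteractionEquation.continuous_neg_apply (hUW : SolvesInteractionEquation W V U)
    (s : ℝ) (ψ : E) : Continuous fun t => W (-t) (U t s ψ) :=
  continuous_iff_continuousAt.2 fun t => (hUW s ψ t).continuousAt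

namespace IsUnitaryGroupOf

variable [CompleteSpace E]

theorem eq_of_neg_apply_eq (hW : IsUnitaryGroupOf H₀ W) {t : ℝ} {u v : E}
    (h : W (-t) u = W (-t) v) : u = v := by
  rw [← hW.apply_neg_apply t u, h, hW.apply_neg_apply]

theorem continuous_of_continuous_neg_apply (hW : IsUnitaryGroupOf H₀ W) {x : ℝ → E}
    (hx : Continuous fun t => W (-t) (x t)) : Continuous x := by
  simpa only [hW.apply_neg_apply] using hW.isStronglyContinuous.continuous_apply hx

theorem mul_eq_of_solvesInteractionEquation (hW : IsUnitaryGroupOf H₀ W)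
    (hV : IsStronglyContinuous V) (hUW : SolvesInteractionEquation W V U)
    (hself : ∀ t, U t t = 1) (t r s : ℝ) : U t r * U r s = U t s := by
  ext ψ
  refine hW.eq_of_neg_apply_eq (congrFun (linearODE_solution_unique (g := 0) (t₀ := r)
    (isStronglyContinuous_interactionGenerator (hW.isStronglyContinuous_interaction hV))
    (y := fun t => W (-t) (U t r (U r s ψ))) (z := fun t => W (-t) (U t s ψ))
    (fun τ => ?_) (fun τ => ?_) ?_) t)
  · simpa using hUW r (U r s ψ) τ
  · simpa using hUW s ψ τ
  · rw [hself, one_apply_eq_self]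

end IsUnitaryGroupOf

/-- `U(t,s) = e^{-itH₀} Ũ(t,s) e^{isH₀}` for the group `W t = e^{-itH₀}`, where `Ũ` is the sum of
the Dyson series of the interaction-picture perturbation. -/
def IsDysonPropagator (W V : ℝ → E →L[ℂ] E) (U : ℝ → ℝ → E →L[ℂ] E) : Prop :=
  ∀ t s ψ, U t s ψ = W t (∑' n, dysonTerm W V s (W (-s) ψ) n t)

namespace IsDysonPropagator

variable [CompleteSpace E]

theorem map_self (hU : IsDysonPropagator W V U) (hW : IsUnitaryGroupOf H₀ W) (t : ℝ) :
    U t t = 1 := by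
  ext ψ
  rw [hU, tsum_dysonTerm_self, hW.apply_neg_apply, one_apply_eq_self]

theorem solvesInteractionEquation (hU : IsDysonPropagator W V U) (hW : IsUnitaryGroupOf H₀ W)
    (hV : IsStronglyContinuous V) : SolvesInteractionEquation W V U := fun s ψ t => by
  simp only [hU _ s ψ, hW.neg_apply_apply]
  exact hasDerivAt_tsum_dysonTerm (hW.isStronglyContinuous_interaction hV) s _ t

theorem isBoundedUnder_norm (hU : IsDysonPropagator W V U) (hW : IsUnitaryGroupOf H₀ W)
    (hV : IsStronglyContinuous V) (t s : ℝ) :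
    (𝓝 s).IsBoundedUnder (· ≤ ·) fun r => ‖U t r‖ := by
  obtain ⟨a, b, hs, ht⟩ := exists_mem_Ioo_and_mem_Ioo s t
  obtain ⟨C, hC0, hC⟩ := (hW.isStronglyContinuous_interaction hV).exists_bound_of_isCompact
    (isCompact_Icc (a := a) (b := b))
  refine isBoundedUnder_of_eventually_le (a := Real.exp (C * (b - a))) ?_
  filter_upwards [Ioo_mem_nhds hs.1 hs.2] with r hr
  have htr : |t - r| ≤ b - a := abs_sub_le_of_le_of_le ht.1.le ht.2.le hr.1.le hr.2.le
  refine ContinuousLinearMap.opNorm_le_bound _ (Real.exp_nonneg _) fun ψ => ?_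
  rw [hU, hW.norm_apply, ← hW.norm_apply (-r) ψ]
  exact (norm_tsum_dysonTerm_le ordConnected_Icc hC (Ioo_subset_Icc_self hr)
    (Ioo_subset_Icc_self ht) _).trans (by gcongr)

theorem isReversibleEvolution (hU : IsDysonPropagator W V U) (hW : IsUnitaryGroupOf H₀ W)
    (hV : IsStronglyContinuous V) : IsReversibleEvolution U :=
  have hUW := hU.solvesInteractionEquation hW hV
  have hself := hU.map_self hW
  have hmul := hW.mul_eq_of_solvesInteractionEquation hV hUW hself
  have hleft := fun s ψ => hW.continuous_of_continuous_neg_apply (hUW.continuous_neg_apply s ψ)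
  ⟨hself, hmul, hleft, fun t => isStronglyContinuous_right_of_isBoundedUnder hself hmul hleft
    (hU.isBoundedUnder_norm hW hV t)⟩

end IsDysonPropagator

theorem SolvesInteractionEquation.hasDerivAt_neg_apply_mildSolution [CompleteSpace E]
    (hUW : SolvesInteractionEquation W V U) (hU : IsReversibleEvolution U) {f : ℝ → E}
    (hf : Continuous f) (s : ℝ) (a : E) (t : ℝ) :
    HasDerivAt (fun τ => W (-τ) (mildSolution U f s a τ))
      (interactionGenerator W V t (W (-t) (mildSolution U f s a t)) + W (-t) (f t)) t := by
  have hB : IsStronglyContinuous fun τ => W (-τ) * U τ s := hUW.continuous_neg_apply s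
  simpa only [hU.mildSolution_eq_apply hf, mul_apply_eq_comp, hU.apply_apply, hU.apply_self] using
    hasDerivAt_clm_apply (hB.isBoundedUnder_norm t) (hB _).continuousAt (hUW s _ t)
      (hU.hasDerivAt_primitive hf s a t)

end EvolutionFamily

section WeakSolution

variable {E : Type*} [NormedAddCommGroup E] [InnerProductSpace ℂ E]
  {H₀ : E →ₗ.[ℂ] E} {W V : ℝ → E →L[ℂ] E} {U : ℝ → ℝ → E →L[ℂ] E} {f x : ℝ → E}

theorem isWeakSolutionOn_of_eventuallyEq {J : Set ℝ}
    (hx : ∀ t ∈ J, ∃ y, IsWeakSolutionOn H₀ V f y univ ∧ x =ᶠ[𝓝 t] y) :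
    IsWeakSolutionOn H₀ V f x J := fun η t ht => by
  obtain ⟨y, hy, hxy⟩ := hx t ht
  rw [hxy.eq_of_nhds]
  exact (hy η t trivial).congr_of_eventuallyEq (hxy.mono fun τ hτ => by simp only [hτ])

theorem IsWeakSolutionOn.hasDerivAt_inner_left (hx : IsWeakSolutionOn H₀ V f x univ)
    (η : H₀.domain) (t : ℝ) : HasDerivAt (fun τ => ⟪x τ, (η : E)⟫_ℂ)
      (Complex.I * ⟪x t, H₀ η⟫_ℂ + Complex.I * ⟪V t (x t), (η : E)⟫_ℂ + ⟪f t, (η : E)⟫_ℂ) t := by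
  have h := (hx η t trivial).star
  simp only [RCLike.star_def, inner_conj_symm] at h
  refine h.congr_deriv ?_
  simp only [map_add, map_sub, map_mul, map_neg, Complex.conj_I, inner_conj_symm]
  ring

variable [CompleteSpace E]

theorem isWeakSolutionOn_mildSolution (hW : IsUnitaryGroupOf H₀ W)
    (hUW : SolvesInteractionEquation W V U) (hU : IsReversibleEvolution U) (hf : Continuous f)
    (s : ℝ) (a : E) : IsWeakSolutionOn H₀ V f (mildSolution U f s a) univ := fun η t _ => by
  have hderiv := (hW.hasDerivAt_neg t η).inner ℂ
    (hUW.hasDerivAt_neg_apply_mildSolution hU hf s a t)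
  simp only [hW.inner_apply_apply] at hderiv
  refine hderiv.congr_deriv ?_
  simp only [interactionGenerator_apply, hW.apply_neg_apply, inner_add_right, inner_smul_right,
    inner_smul_left, hW.inner_apply_apply, Complex.conj_I]
  ring

theorem IsWeakSolutionOn.hasDerivAt_inner_neg_apply (hW : IsUnitaryGroupOf H₀ W)
    (hdense : Dense (H₀.domain : Set E)) (hx : IsWeakSolutionOn H₀ V f x univ)
    (hb : ∀ t, (𝓝 t).IsBoundedUnder (· ≤ ·) fun τ => ‖x τ‖) (η : H₀.domain) (t : ℝ) :
    HasDerivAt (fun τ => ⟪(η : E), W (-τ) (x τ)⟫_ℂ)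
      ⟪(η : E), interactionGenerator W V t (W (-t) (x t)) + W (-t) (f t)⟫_ℂ t := by
  -- `⟪η, W (-t) x⟫ = ⟪W t η, x⟫` is differentiated by the product rule. A weak solution is only
  -- weakly differentiable, so `x` is treated as the operator family `innerSL ℂ (x t)`.
  have hb' : (𝓝 t).IsBoundedUnder (· ≤ ·) fun τ => ‖innerSL ℂ (x τ)‖ := by
    simpa only [innerSL_apply_norm] using hb t
  have hcont := continuousAt_clm_apply_of_dense hdense hb' fun ζ hζ =>
    (hx.hasDerivAt_inner_left ⟨ζ, hζ⟩ t).continuousAt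
  obtain ⟨hmem, hcomm⟩ := hW.apply_mem_domain t η
  have hderiv := (hasDerivAt_clm_apply hb' (hcont _) (hx.hasDerivAt_inner_left ⟨_, hmem⟩ t)
    (hW.hasDerivAt t η)).star
  simp only [RCLike.star_def, innerSL_apply_apply, inner_conj_symm, hW.inner_apply_left] at hderiv
  refine hderiv.congr_deriv ?_
  simp only [hcomm, interactionGenerator_apply, hW.apply_neg_apply, inner_add_right,
    inner_smul_right, map_add, map_mul, map_neg, Complex.conj_I, inner_conj_symm,
    hW.inner_apply_left]
  ring

theorem IsWeakSolutionOn.eq_mildSolution (hW : IsUnitaryGroupOf H₀ W)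
    (hUW : SolvesInteractionEquation W V U) (hU : IsReversibleEvolution U)
    (hV : IsStronglyContinuous V) (hdense : Dense (H₀.domain : Set E)) (hf : Continuous f)
    (hx : IsWeakSolutionOn H₀ V f x univ)
    (hb : ∀ t, (𝓝 t).IsBoundedUnder (· ≤ ·) fun τ => ‖x τ‖) (s : ℝ) :
    x = mildSolution U f s (x s) := by
  have hN := isStronglyContinuous_interactionGenerator (hW.isStronglyContinuous_interaction hV)
  have hWf := hW.isStronglyContinuous_neg.continuous_apply hf
  set y : ℝ → E := fun t => W (-t) (x t)
  have hweak : ∀ η ∈ (H₀.domain : Set E), ∀ t, HasDerivAt (fun τ => ⟪η, y τ⟫_ℂ)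
      ⟪η, interactionGenerator W V t (y t) + W (-t) (f t)⟫_ℂ t := fun η hη =>
    hx.hasDerivAt_inner_neg_apply hW hdense hb ⟨η, hη⟩
  have hy : Continuous y := by
    refine continuous_iff_continuousAt.2 fun t => continuousAt_of_hasDerivAt_inner hdense hweak ?_
    obtain ⟨C, hC⟩ := (hb t).eventually_le
    obtain ⟨K, hK⟩ := (hN.isBoundedUnder_norm t).eventually_le
    obtain ⟨B, hB⟩ := hWf.continuousAt.norm.isBoundedUnder_le.eventually_le
    refine isBoundedUnder_of_eventually_le (a := K * C + B) ?_
    filter_upwards [hC, hK, hB] with τ hC hK hB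
    exact norm_add_le_of_le
      (ContinuousLinearMap.le_of_opNorm_le_of_le _ hK ((hW.norm_apply _ _).trans_le hC)) hB
  have hderiv := fun t => hasDerivAt_of_hasDerivAt_inner hdense hweak (t := t)
    ((hN.continuous_apply hy).add hWf).continuousAt
  funext t
  refine hW.eq_of_neg_apply_eq (congrFun (linearODE_solution_unique (t₀ := s) hN hderiv
    (hUW.hasDerivAt_neg_apply_mildSolution hU hf s (x s)) ?_) t)
  rw [hU.mildSolution_self]

end WeakSolution

section ExponentialKernel

variable {α : ℝ}

theorem exp_neg_mul_sub (α t τ : ℝ) :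
    Real.exp (-α * (τ - t)) = Real.exp (α * t) * Real.exp (-α * τ) := by
  rw [← Real.exp_add]
  ring_nf

theorem integrableOn_Ioi_exp_neg_mul_sub (hα : 0 < α) (t : ℝ) :
    IntegrableOn (fun τ => Real.exp (-α * (τ - t))) (Ioi t) := by
  simp only [exp_neg_mul_sub]
  exact (exp_neg_integrableOn_Ioi t hα).const_mul _

theorem integral_Ioi_exp_neg_mul_sub (hα : 0 < α) (t : ℝ) :
    ∫ τ in Ioi t, Real.exp (-α * (τ - t)) = α⁻¹ := by
  simp only [exp_neg_mul_sub]
  rw [integral_const_mul, integral_exp_mul_Ioi (neg_lt_zero.2 hα), neg_div_neg_eq, mul_div_assoc',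
    ← Real.exp_add, neg_mul, add_neg_cancel, Real.exp_zero, one_div]

theorem integral_exp_neg_mul_sub_le (hα : 0 < α) {s t : ℝ} (hst : s ≤ t) :
    ∫ τ in s..t, Real.exp (-α * (t - τ)) ≤ α⁻¹ := by
  rw [intervalIntegral.integral_comp_sub_left (fun τ => Real.exp (-α * τ)) t, sub_self,
    intervalIntegral.integral_of_le (sub_nonneg.2 hst), ← integral_Ioi_exp_neg_mul_sub hα 0]
  simp only [sub_zero]
  exact setIntegral_mono_set (by simpa using integrableOn_Ioi_exp_neg_mul_sub hα 0)
    (Eventually.of_forall fun τ => (Real.exp_nonneg _)) Ioc_subset_Ioi_self.eventuallyLE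

end ExponentialKernel

section ForwardDichotomy

variable {E : Type*} [NormedAddCommGroup E] [InnerProductSpace ℂ E]
  {U : ℝ → ℝ → E →L[ℂ] E} {P : ℝ → E →L[ℂ] E} {J : Set ℝ}

/-- `∫_t^∞ U(t,τ) (I - P(τ)) f(τ) dτ`: minus the unstable component at time `t` of a solution which
stays bounded as time tends to `∞`. -/
def forwardTail (U : ℝ → ℝ → E →L[ℂ] E) (P : ℝ → E →L[ℂ] E) (f : ℝ → E) (t : ℝ) : E :=
  ∫ τ in Ioi t, U t τ ((1 - P τ) (f τ))

namespace HasExpDichotomyOn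

theorem proj_proj (hP : HasExpDichotomyOn U J P) {t : ℝ} (ht : t ∈ J) (v : E) :
    P t (P t v) = P t v :=
  congrArg (· v) (hP.idem t ht)

theorem apply_proj (hP : HasExpDichotomyOn U J P) (hU : IsReversibleEvolution U) {s t : ℝ}
    (hs : s ∈ J) (ht : t ∈ J) (v : E) : U t s (P s v) = P t (U t s v) := by
  rcases le_total s t with hst | hts
  · exact congrArg (· v) (hP.comm t ht s hs hst)
  · have h : U s t (P t (U t s v)) = P s (U s t (U t s v)) :=
      congrArg (· (U t s v)) (hP.comm s hs t ht hts)
    rw [hU.apply_apply, hU.apply_self] at h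
    rw [← h, hU.apply_apply, hU.apply_self]

theorem apply_one_sub_proj (hP : HasExpDichotomyOn U J P) (hU : IsReversibleEvolution U)
    {s t : ℝ} (hs : s ∈ J) (ht : t ∈ J) (v : E) :
    U t s ((1 - P s) v) = (1 - P t) (U t s v) := by
  simp only [sub_apply, one_apply_eq_self, map_sub, hP.apply_proj hU hs ht]

theorem exists_norm_apply_le (hP : HasExpDichotomyOn U J P) (B : ℝ) :
    ∃ M α : ℝ, 0 ≤ M ∧ 0 < α ∧ ∀ t ∈ J, ∀ s ∈ J, s ≤ t → ∀ v, ‖v‖ ≤ B →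
      ‖U t s (P s v)‖ ≤ M * Real.exp (-α * (t - s)) ∧
      ‖U s t ((1 - P t) v)‖ ≤ M * Real.exp (-α * (t - s)) := by
  obtain ⟨M, α, hα, hb⟩ := hP.bound
  have hM : ∀ {A : E →L[ℂ] E} {r : ℝ} {v : E}, ‖A‖ ≤ M * Real.exp r → ‖v‖ ≤ B →
      ‖A v‖ ≤ |M| * |B| * Real.exp r := fun {A r v} hA hv =>
    calc ‖A v‖ ≤ M * Real.exp r * B := A.le_of_opNorm_le_of_le hA hv
      _ ≤ |M| * Real.exp r * |B| := by
        gcongr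
        exacts [(norm_nonneg v).trans hv, le_abs_self M, le_abs_self B]
      _ = |M| * |B| * Real.exp r := mul_right_comm _ _ _
  exact ⟨|M| * |B|, α, by positivity, hα, fun t ht s hs hst v hv =>
    ⟨hM (A := U t s * P s) (hb t ht s hs hst).1 hv,
      hM (A := U s t * (1 - P t)) (hb t ht s hs hst).2 hv⟩⟩

variable (f : ℝ →ᵇ E) {s t : ℝ}

theorem exists_norm_forwardTail_le (hP : HasExpDichotomyOn U (Ici s) P) :
    ∃ C, ∀ t, s ≤ t → ‖forwardTail U P f t‖ ≤ C := by
  obtain ⟨M, α, -, hα, hb⟩ := hP.exists_norm_apply_le ‖f‖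
  refine ⟨M * α⁻¹, fun t hst => ?_⟩
  rw [← integral_Ioi_exp_neg_mul_sub hα t, ← integral_const_mul]
  refine norm_integral_le_of_norm_le ((integrableOn_Ioi_exp_neg_mul_sub hα t).const_mul M) ?_
  filter_upwards [ae_restrict_mem measurableSet_Ioi] with τ hτ
  exact (hb τ (hst.trans (le_of_lt hτ)) t hst (le_of_lt hτ) _ (f.norm_coe_le_norm τ)).2

theorem exists_norm_integral_proj_le (hP : HasExpDichotomyOn U (Ici s) P) :
    ∃ C, ∀ t, s ≤ t → ‖∫ τ in s..t, U t τ (P τ (f τ))‖ ≤ C := by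
  obtain ⟨M, α, hM, hα, hb⟩ := hP.exists_norm_apply_le ‖f‖
  refine ⟨M * α⁻¹, fun t hst => (intervalIntegral.norm_integral_le_of_norm_le hst
    (g := fun τ => M * Real.exp (-α * (t - τ))) (Eventually.of_forall fun τ hτ =>
      (hb t hst τ hτ.1.le hτ.2 _ (f.norm_coe_le_norm τ)).1)
    (Continuous.intervalIntegrable (by fun_prop) _ _)).trans ?_⟩
  rw [intervalIntegral.integral_const_mul]
  gcongr
  exact integral_exp_neg_mul_sub_le hα hst

theorem exists_norm_apply_proj_le (hP : HasExpDichotomyOn U (Ici s) P) (v : E) :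
    ∃ C, ∀ t, s ≤ t → ‖U t s (P s v)‖ ≤ C := by
  obtain ⟨M, α, hM, hα, hb⟩ := hP.exists_norm_apply_le ‖v‖
  refine ⟨M, fun t hst => (hb t hst s self_mem_Ici hst v le_rfl).1.trans ?_⟩
  refine mul_le_of_le_one_right hM (Real.exp_le_one_iff.2 ?_)
  nlinarith

variable [CompleteSpace E]

theorem integrableOn_Ioi (hP : HasExpDichotomyOn U (Ici s) P) (hU : IsReversibleEvolution U)
    (hst : s ≤ t) : IntegrableOn (fun τ => U t τ ((1 - P τ) (f τ))) (Ioi t) := by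
  obtain ⟨M, α, -, hα, hb⟩ := hP.exists_norm_apply_le ‖f‖
  have hcont : ContinuousOn (fun τ => U t τ ((1 - P τ) (f τ))) (Ioi t) :=
    ((1 - P t).continuous.comp (hU.continuous_apply f.continuous t)).continuousOn.congr
      fun τ hτ => hP.apply_one_sub_proj hU (hst.trans (le_of_lt hτ)) hst (f τ)
  refine Integrable.mono' ((integrableOn_Ioi_exp_neg_mul_sub hα t).const_mul M)
    (hcont.aestronglyMeasurable measurableSet_Ioi) ?_
  filter_upwards [ae_restrict_mem measurableSet_Ioi] with τ hτ
  exact (hb τ (hst.trans (le_of_lt hτ)) t hst (le_of_lt hτ) _ (f.norm_coe_le_norm τ)).2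

theorem proj_forwardTail (hP : HasExpDichotomyOn U (Ici s) P) (hU : IsReversibleEvolution U)
    (hst : s ≤ t) : P t (forwardTail U P f t) = 0 := by
  rw [forwardTail, ← (P t).integral_comp_comm (hP.integrableOn_Ioi f hU hst)]
  refine setIntegral_eq_zero_of_forall_eq_zero fun τ hτ => ?_
  rw [hP.apply_one_sub_proj hU (hst.trans (le_of_lt hτ)) hst, sub_apply,
    one_apply_eq_self, map_sub, hP.proj_proj hst, sub_self]

theorem intervalIntegrable_one_sub_proj (hP : HasExpDichotomyOn U (Ici s) P)
    (hU : IsReversibleEvolution U) (hst : s ≤ t) :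
    IntervalIntegrable (fun τ => U s τ ((1 - P τ) (f τ))) volume s t :=
  (intervalIntegrable_iff_integrableOn_Ioc_of_le hst).2
    ((hP.integrableOn_Ioi f hU le_rfl).mono_set Ioc_subset_Ioi_self)

theorem one_sub_proj_add_integral (hP : HasExpDichotomyOn U (Ici s) P)
    (hU : IsReversibleEvolution U) (a : E) (hst : s ≤ t) :
    (1 - P s) a + ∫ τ in s..t, U s τ ((1 - P τ) (f τ)) =
      U s t ((1 - P t) (mildSolution U f s a t)) := by
  rw [hP.apply_one_sub_proj hU hst self_mem_Ici, hU.mildSolution_eq_apply f.continuous,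
    hU.apply_apply, hU.apply_self, map_add, ← (1 - P s).intervalIntegral_comp_comm
      ((hU.continuous_apply f.continuous s).intervalIntegrable _ _)]
  congr 1
  refine intervalIntegral.integral_congr fun τ hτ => ?_
  rw [uIcc_of_le hst] at hτ
  exact hP.apply_one_sub_proj hU hτ.1 self_mem_Ici (f τ)

theorem mildSolution_sub_forwardTail (hP : HasExpDichotomyOn U (Ici s) P)
    (hU : IsReversibleEvolution U) (b : E) (hst : s ≤ t) :
    mildSolution U f s (b - forwardTail U P f s) t =
      (∫ τ in s..t, U t τ (P τ (f τ))) - forwardTail U P f t + U t s b := by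
  have hint := hP.integrableOn_Ioi f hU (le_refl s)
  have hstable : ∫ τ in s..t, U t τ (P τ (f τ)) =
      U t s ((∫ τ in s..t, U s τ (f τ)) - ∫ τ in s..t, U s τ ((1 - P τ) (f τ))) := by
    rw [← intervalIntegral.integral_sub
      ((hU.continuous_apply f.continuous s).intervalIntegrable _ _)
      (hP.intervalIntegrable_one_sub_proj f hU hst), ← (U t s).intervalIntegral_comp_comm
      (((hU.continuous_apply f.continuous s).intervalIntegrable _ _).sub
      (hP.intervalIntegrable_one_sub_proj f hU hst))]
    simp only [sub_apply, one_apply_eq_self, map_sub, sub_sub_cancel,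
      hU.apply_apply]
  have htail : forwardTail U P f t = U t s (∫ τ in Ioi t, U s τ ((1 - P τ) (f τ))) := by
    rw [← (U t s).integral_comp_comm (hint.mono_set (Ioi_subset_Ioi hst))]
    simp only [hU.apply_apply, forwardTail]
  rw [hU.mildSolution_eq_apply f.continuous, hstable, htail, forwardTail,
    ← intervalIntegral.integral_interval_add_Ioi hint (hint.mono_set (Ioi_subset_Ioi hst)),
    ← map_sub, ← map_add]
  congr 1
  abel

theorem one_sub_proj_eq_neg_forwardTail (hP : HasExpDichotomyOn U (Ici s) P)
    (hU : IsReversibleEvolution U) {a : E} {C : ℝ}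
    (hC : ∀ t, s ≤ t → ‖mildSolution U f s a t‖ ≤ C) :
    (1 - P s) a = -forwardTail U P f s := by
  obtain ⟨M, α, -, hα, hb⟩ := hP.exists_norm_apply_le C
  have hdecay : Tendsto (fun t => Real.exp (-α * (t - s))) atTop (𝓝 0) :=
    Real.tendsto_exp_atBot.comp ((tendsto_atTop_add_const_right _ (-s)
      tendsto_id).const_mul_atTop_of_neg (neg_lt_zero.2 hα))
  have hzero : Tendsto (fun t => (1 - P s) a + ∫ τ in s..t, U s τ ((1 - P τ) (f τ))) atTop
      (𝓝 0) := by
    refine squeeze_zero_norm' ?_ (by simpa only [mul_zero] using hdecay.const_mul M)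
    filter_upwards [eventually_ge_atTop s] with t hst
    rw [hP.one_sub_proj_add_integral f hU a hst]
    exact (hb t hst s self_mem_Ici hst _ (hC t hst)).2
  have hlim := intervalIntegral_tendsto_integral_Ioi s (hP.integrableOn_Ioi f hU le_rfl) tendsto_id
  exact eq_neg_of_add_eq_zero_left (tendsto_nhds_unique (hlim.const_add _) hzero)

theorem exists_norm_mildSolution_le_iff (hP : HasExpDichotomyOn U (Ici s) P)
    (hU : IsReversibleEvolution U) (a : E) :
    (∃ C, ∀ t, s ≤ t → ‖mildSolution U f s a t‖ ≤ C) ↔ (1 - P s) a = -forwardTail U P f s := by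
  refine ⟨fun ⟨C, hC⟩ => hP.one_sub_proj_eq_neg_forwardTail f hU hC, fun ha => ?_⟩
  obtain ⟨C₁, hC₁⟩ := hP.exists_norm_integral_proj_le f
  obtain ⟨C₂, hC₂⟩ := hP.exists_norm_forwardTail_le f
  obtain ⟨C₃, hC₃⟩ := hP.exists_norm_apply_proj_le a
  have ha' : a = P s a - forwardTail U P f s := by
    rw [sub_eq_add_neg, ← ha, sub_apply, one_apply_eq_self, add_sub_cancel]
  refine ⟨C₁ + C₂ + C₃, fun t hst => ?_⟩
  rw [ha', hP.mildSolution_sub_forwardTail f hU _ hst]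
  exact norm_add_le_of_le (norm_sub_le_of_le (hC₁ t hst) (hC₂ t hst)) (hC₃ t hst)

end HasExpDichotomyOn

end ForwardDichotomy

section BackwardDichotomy

variable {E : Type*} [NormedAddCommGroup E]

/-- The forcing term of the equation satisfied by `t ↦ x(-t)`, where `f` is that of `x`. -/
def reverseForcing (f : ℝ →ᵇ E) : ℝ →ᵇ E := -f.compContinuous ⟨Neg.neg, continuous_neg⟩

theorem reverseForcing_apply (f : ℝ →ᵇ E) (t : ℝ) : reverseForcing f t = -f (-t) := rfl

variable [InnerProductSpace ℂ E] {U : ℝ → ℝ → E →L[ℂ] E} {P : ℝ → E →L[ℂ] E}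

/-- `∫_{-∞}^t U(t,τ) P(τ) f(τ) dτ`: the stable component at time `t` of a solution which stays
bounded as time tends to `-∞`. -/
def backwardTail (U : ℝ → ℝ → E →L[ℂ] E) (P : ℝ → E →L[ℂ] E) (f : ℝ → E) (t : ℝ) : E :=
  ∫ τ in Iic t, U t τ (P τ (f τ))

/-- The evolution family of `t ↦ φ(-t)`, where `φ` evolves under `U`. -/
def reverseEvolution (U : ℝ → ℝ → E →L[ℂ] E) (t s : ℝ) : E →L[ℂ] E := U (-t) (-s)

theorem IsReversibleEvolution.reverse (hU : IsReversibleEvolution U) :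
    IsReversibleEvolution (reverseEvolution U) where
  map_self t := hU.map_self (-t)
  map_mul t r s := hU.map_mul (-t) (-r) (-s)
  continuous_left s v := (hU.continuous_left (-s) v).comp continuous_neg
  continuous_right t v := (hU.continuous_right (-t) v).comp continuous_neg

theorem mildSolution_reverse (f : ℝ →ᵇ E) (s : ℝ) (a : E) (t : ℝ) :
    mildSolution (reverseEvolution U) (reverseForcing f) (-s) a (-t) = mildSolution U f s a t := by
  simp only [mildSolution, reverseEvolution, reverseForcing_apply, neg_neg, map_neg,
    intervalIntegral.integral_neg]
  rw [intervalIntegral.integral_comp_neg (fun τ => U t τ (f τ)), neg_neg, neg_neg,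
    ← intervalIntegral.integral_symm]

theorem forwardTail_reverse (f : ℝ →ᵇ E) (t : ℝ) :
    forwardTail (reverseEvolution U) (fun τ => 1 - P (-τ)) (reverseForcing f) (-t) =
      -backwardTail U P f t := by
  simp only [forwardTail, reverseEvolution, reverseForcing_apply, neg_neg, map_neg, sub_sub_cancel]
  rw [integral_neg, integral_comp_neg_Ioi (-t) fun τ => U t τ (P τ (f τ)), neg_neg, backwardTail]

namespace HasExpDichotomyOn

theorem reverse {J : Set ℝ} (hP : HasExpDichotomyOn U J P) (hU : IsReversibleEvolution U) :
    HasExpDichotomyOn (reverseEvolution U) (Neg.neg ⁻¹' J) fun t => 1 - P (-t) where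
  idem t ht := IsIdempotentElem.one_sub (hP.idem (-t) ht)
  comm t ht s hs _ := ContinuousLinearMap.ext fun v => hP.apply_one_sub_proj hU hs ht v
  bound := by
    obtain ⟨M, α, hα, hb⟩ := hP.bound
    refine ⟨M, α, hα, fun t ht s hs hst => ?_⟩
    rw [sub_sub_cancel, ← neg_sub_neg s t]
    exact (hb (-s) hs (-t) ht (neg_le_neg hst)).symm

theorem reverse_Iic {s : ℝ} (hP : HasExpDichotomyOn U (Iic s) P)
    (hU : IsReversibleEvolution U) :
    HasExpDichotomyOn (reverseEvolution U) (Ici (-s)) fun t => 1 - P (-t) := by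
  have hset : Neg.neg ⁻¹' Iic s = Ici (-s) := ext fun τ => (neg_le : -τ ≤ s ↔ -s ≤ τ)
  exact hset ▸ hP.reverse hU

variable [CompleteSpace E] (f : ℝ →ᵇ E) {s t : ℝ}

theorem integrableOn_Iic (hP : HasExpDichotomyOn U (Iic s) P) (hU : IsReversibleEvolution U)
    (hts : t ≤ s) : IntegrableOn (fun τ => U t τ (P τ (f τ))) (Iic t) := by
  have h := (hP.reverse_Iic hU).integrableOn_Ioi (reverseForcing f) hU.reverse
    (neg_le_neg hts)
  simp only [reverseEvolution, reverseForcing_apply, neg_neg, map_neg,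
    sub_sub_cancel] at h
  have hset : -Ioi (-t) = Iio t := by simp
  rw [integrableOn_Iic_iff_integrableOn_Iio, ← hset]
  simpa only [neg_neg, Pi.neg_apply] using h.neg.comp_neg

theorem proj_backwardTail (hP : HasExpDichotomyOn U (Iic s) P) (hU : IsReversibleEvolution U)
    (hts : t ≤ s) : P t (backwardTail U P f t) = backwardTail U P f t := by
  have h := (hP.reverse_Iic hU).proj_forwardTail (reverseForcing f) hU.reverse
    (neg_le_neg hts)
  rw [forwardTail_reverse, map_neg, neg_neg, neg_eq_zero, sub_apply, one_apply_eq_self] at h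
  exact (sub_eq_zero.1 h).symm

theorem mildSolution_add_backwardTail (hP : HasExpDichotomyOn U (Iic s) P)
    (hU : IsReversibleEvolution U) (b : E) (hts : t ≤ s) :
    mildSolution U f s (b + backwardTail U P f s) t =
      backwardTail U P f t - (∫ τ in t..s, U t τ ((1 - P τ) (f τ))) + U t s b := by
  have h := (hP.reverse_Iic hU).mildSolution_sub_forwardTail (reverseForcing f)
    hU.reverse b (neg_le_neg hts)
  simp only [forwardTail_reverse, sub_neg_eq_add, mildSolution_reverse] at h
  simp only [h, reverseEvolution, reverseForcing_apply, neg_neg, map_neg,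
    intervalIntegral.integral_neg]
  rw [intervalIntegral.integral_comp_neg (fun τ => U t τ ((1 - P τ) (f τ))), neg_neg, neg_neg,
    neg_add_eq_sub]

theorem exists_norm_mildSolution_le_iff_of_Iic (hP : HasExpDichotomyOn U (Iic s) P)
    (hU : IsReversibleEvolution U) (a : E) :
    (∃ C, ∀ t, t ≤ s → ‖mildSolution U f s a t‖ ≤ C) ↔ P s a = backwardTail U P f s := by
  have h := (hP.reverse_Iic hU).exists_norm_mildSolution_le_iff (reverseForcing f)
    hU.reverse a
  rw [forwardTail_reverse, neg_neg, neg_neg, sub_sub_cancel] at h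
  rw [← h]
  refine exists_congr fun C => ⟨fun hC t ht => ?_, fun hC t ht => ?_⟩
  · rw [← neg_neg t, mildSolution_reverse]
    exact hC (-t) (neg_le.1 ht)
  · simpa only [mildSolution_reverse] using hC (-t) (neg_le_neg ht)

end HasExpDichotomyOn

end BackwardDichotomy

section BoundedSolution

variable {E : Type*} [NormedAddCommGroup E] [InnerProductSpace ℂ E] [CompleteSpace E]
  {H₀ : E →ₗ.[ℂ] E} {V : ℝ → E →L[ℂ] E} {U : ℝ → ℝ → E →L[ℂ] E}

namespace IsEvolutionFamily

theorem isReversibleEvolution (hU : IsEvolutionFamily H₀ V U) (hV : IsStronglyContinuous V) :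
    IsReversibleEvolution U :=
  let ⟨_, hW, hUW⟩ := hU
  IsDysonPropagator.isReversibleEvolution hUW hW hV

theorem isWeakSolutionOn_mildSolution (hU : IsEvolutionFamily H₀ V U)
    (hV : IsStronglyContinuous V) {f : ℝ → E} (hf : Continuous f) (s : ℝ) (a : E) :
    IsWeakSolutionOn H₀ V f (mildSolution U f s a) univ :=
  let ⟨_, hW, hUW⟩ := hU
  SchrodingerDichotomy.isWeakSolutionOn_mildSolution hW
    (IsDysonPropagator.solvesInteractionEquation hUW hW hV) (hU.isReversibleEvolution hV) hf s a

theorem isBoundedWeakSolution_iff (hU : IsEvolutionFamily H₀ V U) (hV : IsStronglyContinuous V)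
    (hdense : Dense (H₀.domain : Set E)) {f : ℝ → E} (hf : Continuous f) (s : ℝ) {x : ℝ → E} :
    IsBoundedWeakSolution H₀ V f x ↔
      ∃ a, x = mildSolution U f s a ∧ ∃ C, ∀ t, ‖mildSolution U f s a t‖ ≤ C := by
  constructor
  · rintro ⟨hx, C, hC⟩
    obtain ⟨W, hW, hUW⟩ := id hU
    have heq := hx.eq_mildSolution hW (IsDysonPropagator.solvesInteractionEquation hUW hW hV)
      (hU.isReversibleEvolution hV) hV hdense hf
      (fun _ => isBoundedUnder_of ⟨C, hC⟩) s
    exact ⟨x s, heq, C, fun t => heq ▸ hC t⟩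
  · rintro ⟨a, rfl, hC⟩
    exact ⟨hU.isWeakSolutionOn_mildSolution hV hf s a, hC⟩

end IsEvolutionFamily

end BoundedSolution

section Matching

variable {E : Type*} [NormedAddCommGroup E] [InnerProductSpace ℂ E]
  {U : ℝ → ℝ → E →L[ℂ] E} {Pp Pm : ℝ → E →L[ℂ] E}

theorem matchingOp_apply (v : E) : matchingOp Pp Pm v = Pp 0 v - (v - Pm 0 v) := rfl

theorem one_sub_proj_eq_and_proj_eq_iff (hp : ∀ v, Pp 0 (Pp 0 v) = Pp 0 v)
    (hm : ∀ v, Pm 0 (Pm 0 v) = Pm 0 v) {u w : E} (hu : Pp 0 u = 0) (hw : Pm 0 w = w) {a : E} :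
    (1 - Pp 0) a = -u ∧ Pm 0 a = w ↔ ∃ v, matchingOp Pp Pm v = u + w ∧ a = Pp 0 v - u := by
  simp only [matchingOp_apply, sub_apply, one_apply_eq_self]
  constructor
  · rintro ⟨hua, rfl⟩
    rw [← neg_eq_iff_eq_neg] at hua
    subst hua
    exact ⟨a, by abel, by abel⟩
  · rintro ⟨v, hv, rfl⟩
    have hstable : Pp 0 v - u = v - Pm 0 v + w := by
      rw [sub_eq_iff_eq_add, add_assoc, add_comm w, ← hv, add_sub_cancel]
    constructor
    · rw [map_sub, hp, hu]
      abel
    · rw [hstable, map_add, map_sub, hm, hw, sub_self, zero_add]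

variable [CompleteSpace E]

theorem projCoker_proj_eq (hD : IsGeneralizedInvertible (matchingOp Pp Pm)) (v : E) :
    projCoker (matchingOp Pp Pm) (Pm 0 v) = projCoker (matchingOp Pp Pm) ((1 - Pp 0) v) := by
  rw [← sub_eq_zero, ← map_sub, ← hD.projCoker_apply_apply v, matchingOp_apply, sub_apply,
    one_apply_eq_self]
  congr 1
  abel

variable (f : ℝ →ᵇ E)

theorem exists_norm_mildSolution_le_iff_exists_matchingOp (hU : IsReversibleEvolution U)
    (hp : HasExpDichotomyOn U (Ici 0) Pp) (hm : HasExpDichotomyOn U (Iic 0) Pm) {a : E} :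
    (∃ C, ∀ t, ‖mildSolution U f 0 a t‖ ≤ C) ↔
      ∃ v, matchingOp Pp Pm v = matchingVector U Pp Pm f 0 ∧
        a = Pp 0 v - forwardTail U Pp f 0 := by
  refine Iff.trans ?_ (one_sub_proj_eq_and_proj_eq_iff (hp.proj_proj self_mem_Ici)
    (hm.proj_proj self_mem_Iic) (hp.proj_forwardTail f hU le_rfl)
    (hm.proj_backwardTail f hU le_rfl))
  rw [← hp.exists_norm_mildSolution_le_iff f hU, ← hm.exists_norm_mildSolution_le_iff_of_Iic f hU]
  refine ⟨fun ⟨C, hC⟩ => ⟨⟨C, fun t _ => hC t⟩, ⟨C, fun t _ => hC t⟩⟩, ?_⟩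
  rintro ⟨⟨C₁, hC₁⟩, ⟨C₂, hC₂⟩⟩
  exact ⟨max C₁ C₂, fun t => (le_total 0 t).elim (fun ht => le_max_of_le_left (hC₁ t ht))
    fun ht => le_max_of_le_right (hC₂ t ht)⟩

theorem integrable_solvabilityKernel_and_integral_eq (hU : IsReversibleEvolution U)
    (hp : HasExpDichotomyOn U (Ici 0) Pp) (hm : HasExpDichotomyOn U (Iic 0) Pm)
    (hD : IsGeneralizedInvertible (matchingOp Pp Pm)) :
    Integrable (fun t => solvabilityKernel U Pp Pm t (f t)) ∧
      ∫ t, solvabilityKernel U Pp Pm t (f t) =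
        projCoker (matchingOp Pp Pm) (matchingVector U Pp Pm f 0) := by
  set N := projCoker (matchingOp Pp Pm)
  have hIic : EqOn (fun t => solvabilityKernel U Pp Pm t (f t))
      (fun τ => N (U 0 τ (Pm τ (f τ)))) (Iic 0) := fun τ hτ =>
    congrArg N (hm.apply_proj hU hτ self_mem_Iic (f τ)).symm
  have hIoi : EqOn (fun t => solvabilityKernel U Pp Pm t (f t))
      (fun τ => N (U 0 τ ((1 - Pp τ) (f τ)))) (Ioi 0) := fun τ hτ =>
    (projCoker_proj_eq hD _).trans
      (congrArg N (hp.apply_one_sub_proj hU (Ioi_subset_Ici_self hτ) self_mem_Ici (f τ)).symm)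
  have hm_int := hm.integrableOn_Iic f hU le_rfl
  have hp_int := hp.integrableOn_Ioi f hU le_rfl
  have hIic_int := (integrableOn_congr_fun hIic measurableSet_Iic).2 (N.integrable_comp hm_int)
  have hIoi_int := (integrableOn_congr_fun hIoi measurableSet_Ioi).2 (N.integrable_comp hp_int)
  refine ⟨?_, ?_⟩
  · rw [← integrableOn_univ, ← Iic_union_Ioi (a := (0 : ℝ))]
    exact hIic_int.union hIoi_int
  · rw [← intervalIntegral.integral_Iic_add_Ioi hIic_int hIoi_int,
      setIntegral_congr_fun measurableSet_Iic hIic, setIntegral_congr_fun measurableSet_Ioi hIoi,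
      N.integral_comp_comm hm_int, N.integral_comp_comm hp_int, ← map_add, add_comm,
      matchingVector]

end Matching

section Green

variable {E : Type*} [NormedAddCommGroup E] [InnerProductSpace ℂ E] [CompleteSpace E]
  {U : ℝ → ℝ → E →L[ℂ] E} {Pp Pm : ℝ → E →L[ℂ] E} (f : ℝ →ᵇ E) {s t : ℝ}

theorem greenForward_eq_mildSolution (hU : IsReversibleEvolution U)
    (hp : HasExpDichotomyOn U (Ici s) Pp) (hst : s ≤ t) :
    greenForward U Pp Pm f t s = mildSolution U f s
      (Pp s (pinv (matchingOp Pp Pm) (matchingVector U Pp Pm f s)) - forwardTail U Pp f s) t :=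
  (hp.mildSolution_sub_forwardTail f hU _ hst).symm

theorem greenBackward_eq_mildSolution (hU : IsReversibleEvolution U)
    (hm : HasExpDichotomyOn U (Iic s) Pm) (hts : t ≤ s) :
    greenBackward U Pp Pm f t s = mildSolution U f s
      ((1 - Pm s) (pinv (matchingOp Pp Pm) (matchingVector U Pp Pm f s))
        + backwardTail U Pm f s) t :=
  (hm.mildSolution_add_backwardTail f hU _ hts).symm

theorem greenForward_sub_greenBackward (hU : IsReversibleEvolution U)
    (hp : HasExpDichotomyOn U (Ici 0) Pp) (hm : HasExpDichotomyOn U (Iic 0) Pm)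
    (hD : IsGeneralizedInvertible (matchingOp Pp Pm)) :
    greenForward U Pp Pm f 0 0 - greenBackward U Pp Pm f 0 0 =
      -∫ t, solvabilityKernel U Pp Pm t (f t) := by
  have hg : matchingVector U Pp Pm f 0 = forwardTail U Pp f 0 + backwardTail U Pm f 0 := rfl
  rw [(integrable_solvabilityKernel_and_integral_eq f hU hp hm hD).2,
    greenForward_eq_mildSolution f hU hp le_rfl, greenBackward_eq_mildSolution f hU hm le_rfl,
    hU.mildSolution_self, hU.mildSolution_self, projCoker]
  simp only [sub_apply, one_apply_eq_self, mul_apply_eq_comp, matchingOp_apply]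
  generalize pinv (matchingOp Pp Pm) (matchingVector U Pp Pm f 0) = v
  rw [hg]
  abel

theorem green_of_nonneg (hU : IsReversibleEvolution U) (hp : HasExpDichotomyOn U (Ici 0) Pp)
    (ht : 0 ≤ t) :
    green U Pp Pm f t 0 = mildSolution U f 0 (greenForward U Pp Pm f 0 0) t := by
  rw [green, if_pos ht, greenForward_eq_mildSolution f hU hp ht,
    greenForward_eq_mildSolution f hU hp le_rfl, hU.mildSolution_self]

theorem green_of_neg (hU : IsReversibleEvolution U) (hm : HasExpDichotomyOn U (Iic 0) Pm)
    (ht : t < 0) :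
    green U Pp Pm f t 0 = mildSolution U f 0 (greenBackward U Pp Pm f 0 0) t := by
  rw [green, if_neg (not_le.2 ht), greenBackward_eq_mildSolution f hU hm ht.le,
    greenBackward_eq_mildSolution f hU hm le_rfl, hU.mildSolution_self]

theorem green_eq_mildSolution (hU : IsReversibleEvolution U)
    (hp : HasExpDichotomyOn U (Ici 0) Pp) (hm : HasExpDichotomyOn U (Iic 0) Pm)
    (hmatch : greenForward U Pp Pm f 0 0 = greenBackward U Pp Pm f 0 0) :
    (fun t => green U Pp Pm f t 0) = mildSolution U f 0 (greenForward U Pp Pm f 0 0) := by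
  funext t
  rcases le_or_gt 0 t with ht | ht
  · exact green_of_nonneg f hU hp ht
  · rw [hmatch, green_of_neg f hU hm ht]

theorem tendsto_green_nhdsGT (hU : IsReversibleEvolution U)
    (hp : HasExpDichotomyOn U (Ici 0) Pp) :
    Tendsto (fun t => green U Pp Pm f t 0) (𝓝[>] 0) (𝓝 (greenForward U Pp Pm f 0 0)) := by
  have h := (hU.continuous_mildSolution f.continuous 0 (greenForward U Pp Pm f 0 0)).tendsto 0
  rw [hU.mildSolution_self] at h
  refine (h.mono_left nhdsWithin_le_nhds).congr' ?_
  filter_upwards [self_mem_nhdsWithin] with t ht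
  exact (green_of_nonneg f hU hp (le_of_lt ht)).symm

theorem tendsto_green_nhdsLT (hU : IsReversibleEvolution U)
    (hm : HasExpDichotomyOn U (Iic 0) Pm) :
    Tendsto (fun t => green U Pp Pm f t 0) (𝓝[<] 0) (𝓝 (greenBackward U Pp Pm f 0 0)) := by
  have h := (hU.continuous_mildSolution f.continuous 0 (greenBackward U Pp Pm f 0 0)).tendsto 0
  rw [hU.mildSolution_self] at h
  refine (h.mono_left nhdsWithin_le_nhds).congr' ?_
  filter_upwards [self_mem_nhdsWithin] with t ht
  exact (green_of_neg f hU hm ht).symm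

variable {H₀ : E →ₗ.[ℂ] E} {V : ℝ → E →L[ℂ] E}

theorem IsEvolutionFamily.isWeakSolutionOn_green (hU : IsEvolutionFamily H₀ V U)
    (hV : IsStronglyContinuous V) (hp : HasExpDichotomyOn U (Ici 0) Pp)
    (hm : HasExpDichotomyOn U (Iic 0) Pm) :
    IsWeakSolutionOn H₀ V f (fun t => green U Pp Pm f t 0) {0}ᶜ := by
  have hUr := hU.isReversibleEvolution hV
  refine isWeakSolutionOn_of_eventuallyEq fun t ht => ?_
  rcases lt_or_gt_of_ne ht with ht | ht
  · exact ⟨_, hU.isWeakSolutionOn_mildSolution hV f.continuous 0 _,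
      mem_of_superset (Iio_mem_nhds ht) fun τ hτ => green_of_neg f hUr hm hτ⟩
  · exact ⟨_, hU.isWeakSolutionOn_mildSolution hV f.continuous 0 _,
      mem_of_superset (Ioi_mem_nhds ht) fun τ hτ => green_of_nonneg f hUr hp (le_of_lt hτ)⟩

theorem IsEvolutionFamily.isBoundedWeakSolution_iff_exists_matchingOp
    (hU : IsEvolutionFamily H₀ V U) (hV : IsStronglyContinuous V)
    (hdense : Dense (H₀.domain : Set E)) (hp : HasExpDichotomyOn U (Ici 0) Pp)
    (hm : HasExpDichotomyOn U (Iic 0) Pm) {x : ℝ → E} :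
    IsBoundedWeakSolution H₀ V f x ↔ ∃ v, matchingOp Pp Pm v = matchingVector U Pp Pm f 0 ∧
      x = mildSolution U f 0 (Pp 0 v - forwardTail U Pp f 0) := by
  simp only [hU.isBoundedWeakSolution_iff hV hdense f.continuous 0,
    exists_norm_mildSolution_le_iff_exists_matchingOp f (hU.isReversibleEvolution hV) hp hm]
  constructor
  · rintro ⟨_, hx, v, hv, rfl⟩
    exact ⟨v, hv, hx⟩
  · rintro ⟨v, hv, hx⟩
    exact ⟨_, hx, v, hv, rfl⟩

theorem IsEvolutionFamily.exists_isBoundedWeakSolution_iff (hU : IsEvolutionFamily H₀ V U)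
    (hV : IsStronglyContinuous V) (hdense : Dense (H₀.domain : Set E))
    (hp : HasExpDichotomyOn U (Ici 0) Pp) (hm : HasExpDichotomyOn U (Iic 0) Pm)
    (hD : IsGeneralizedInvertible (matchingOp Pp Pm)) :
    (∃ x, IsBoundedWeakSolution H₀ V f x) ↔ ∫ t, solvabilityKernel U Pp Pm t (f t) = 0 := by
  simp only [hU.isBoundedWeakSolution_iff_exists_matchingOp f hV hdense hp hm]
  rw [(integrable_solvabilityKernel_and_integral_eq f (hU.isReversibleEvolution hV) hp hm hD).2,
    ← hD.exists_apply_eq_iff]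
  exact ⟨fun ⟨_, v, hv, _⟩ => ⟨v, hv⟩, fun ⟨v, hv⟩ => ⟨_, v, hv, rfl⟩⟩

theorem IsEvolutionFamily.isBoundedWeakSolution_iff_exists_green (hU : IsEvolutionFamily H₀ V U)
    (hV : IsStronglyContinuous V) (hdense : Dense (H₀.domain : Set E))
    (hp : HasExpDichotomyOn U (Ici 0) Pp) (hm : HasExpDichotomyOn U (Iic 0) Pm)
    (hD : IsGeneralizedInvertible (matchingOp Pp Pm))
    (hf : ∫ t, solvabilityKernel U Pp Pm t (f t) = 0) {x : ℝ → E} :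
    IsBoundedWeakSolution H₀ V f x ↔ ∃ c, ∀ t,
      x t = U t 0 (Pp 0 (projKer (matchingOp Pp Pm) c)) + green U Pp Pm f t 0 := by
  have hUr := hU.isReversibleEvolution hV
  have hmatch := greenForward_sub_greenBackward f hUr hp hm hD
  rw [hf, neg_zero, sub_eq_zero] at hmatch
  rw [(integrable_solvabilityKernel_and_integral_eq f hUr hp hm hD).2] at hf
  have hgreen := congrFun (green_eq_mildSolution f hUr hp hm hmatch)
  rw [greenForward_eq_mildSolution f hUr hp le_rfl, hUr.mildSolution_self] at hgreen
  simp only [hU.isBoundedWeakSolution_iff_exists_matchingOp f hV hdense hp hm,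
    hD.apply_eq_iff_of_projCoker_eq_zero hf, funext_iff, hgreen, mildSolution, ← add_assoc,
    ← map_add]
  constructor
  · rintro ⟨_, ⟨c, rfl⟩, hx⟩
    exact ⟨c, by simpa only [map_add, add_sub_assoc] using hx⟩
  · rintro ⟨c, hx⟩
    exact ⟨_, ⟨c, rfl⟩, by simpa only [map_add, add_sub_assoc] using hx⟩

end Green

end SchrodingerDichotomy

end

theorem theorem1 {E : Type*} [NormedAddCommGroup E] [InnerProductSpace ℂ E] [CompleteSpace E]
    (H₀ : E →ₗ.[ℂ] E) (hH₀ : IsSelfAdjoint H₀)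
    (V : ℝ → E →L[ℂ] E) (hV : ∀ ψ : E, Continuous fun t => V t ψ)
    (U : ℝ → ℝ → E →L[ℂ] E) (hU : SchrodingerDichotomy.IsEvolutionFamily H₀ V U)
    (Pp Pm : ℝ → E →L[ℂ] E)
    (hp : SchrodingerDichotomy.HasExpDichotomyOn U (Set.Ici 0) Pp)
    (hm : SchrodingerDichotomy.HasExpDichotomyOn U (Set.Iic 0) Pm)
    (hD : SchrodingerDichotomy.IsGeneralizedInvertible (SchrodingerDichotomy.matchingOp Pp Pm))
    (f : ℝ →ᵇ E) :
    -- all improper integrals below converge absolutely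
    Integrable (fun t => SchrodingerDichotomy.solvabilityKernel U Pp Pm t (f t)) ∧
    (∀ t : ℝ, 0 ≤ t → IntegrableOn (fun τ => U t τ ((1 - Pp τ) (f τ))) (Set.Ioi t)) ∧
    (∀ t : ℝ, t ≤ 0 → IntegrableOn (fun τ => U t τ (Pm τ (f τ))) (Set.Iic t)) ∧
    -- solvability
    ((∃ x : ℝ → E, SchrodingerDichotomy.IsBoundedWeakSolution H₀ V f x) ↔
      ∫ t, SchrodingerDichotomy.solvabilityKernel U Pp Pm t (f t) = 0) ∧
    -- the bounded weak solutions, and the equation satisfied by the Green operator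
    (∫ t, SchrodingerDichotomy.solvabilityKernel U Pp Pm t (f t) = 0 →
      (∀ x : ℝ → E, SchrodingerDichotomy.IsBoundedWeakSolution H₀ V f x ↔
        ∃ c : E, ∀ t, x t =
          U t 0 (Pp 0 (SchrodingerDichotomy.projKer (SchrodingerDichotomy.matchingOp Pp Pm) c))
            + SchrodingerDichotomy.green U Pp Pm f t 0) ∧
      SchrodingerDichotomy.greenForward U Pp Pm f 0 0
        = SchrodingerDichotomy.greenBackward U Pp Pm f 0 0 ∧
      SchrodingerDichotomy.IsWeakSolutionOn H₀ V f
        (fun t => SchrodingerDichotomy.green U Pp Pm f t 0) Set.univ) ∧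
    -- without the solvability condition: the equation away from `0` and the jump at `0`
    SchrodingerDichotomy.IsWeakSolutionOn H₀ V f
      (fun t => SchrodingerDichotomy.green U Pp Pm f t 0) {0}ᶜ ∧
    (∃ a b : E,
      Tendsto (fun t => SchrodingerDichotomy.green U Pp Pm f t 0) (𝓝[>] 0) (𝓝 a) ∧
      Tendsto (fun t => SchrodingerDichotomy.green U Pp Pm f t 0) (𝓝[<] 0) (𝓝 b) ∧
      a - b = -∫ t, SchrodingerDichotomy.solvabilityKernel U Pp Pm t (f t)) := by
  have hUr := hU.isReversibleEvolution hV
  have hdense := hH₀.dense_domain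
  have hjump := SchrodingerDichotomy.greenForward_sub_greenBackward f hUr hp hm hD
  refine ⟨(SchrodingerDichotomy.integrable_solvabilityKernel_and_integral_eq f hUr hp hm hD).1,
    fun t ht => hp.integrableOn_Ioi f hUr ht, fun t ht => hm.integrableOn_Iic f hUr ht,
    hU.exists_isBoundedWeakSolution_iff f hV hdense hp hm hD, fun hf => ?_,
    hU.isWeakSolutionOn_green f hV hp hm, _, _,
    SchrodingerDichotomy.tendsto_green_nhdsGT f hUr hp,
    SchrodingerDichotomy.tendsto_green_nhdsLT f hUr hm, hjump⟩
  have hmatch : SchrodingerDichotomy.greenForward U Pp Pm f 0 0 =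
      SchrodingerDichotomy.greenBackward U Pp Pm f 0 0 := by
    rwa [hf, neg_zero, sub_eq_zero] at hjump
  refine ⟨fun x => hU.isBoundedWeakSolution_iff_exists_green f hV hdense hp hm hD hf, hmatch, ?_⟩
  rw [SchrodingerDichotomy.green_eq_mildSolution f hUr hp hm hmatch]
  exact hU.isWeakSolutionOn_mildSolution hV f.continuous 0 _
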